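/- Let $n\ge 1$ be an integer and let $\lambda_1,\dots,\lambda_n\ge 0$ be real numbers with $\lambda_1=0$. For every integer $N\ge 1$ put $\nu_i=\lambda_i N$ and consider the weight on $\mathbb C$ $$\omega_{n,N}(z)=\int_{\mathbb C^n}\prod_{j=1}^n\frac{|x_j|^{2\nu_j}}{(1+|x_j|^2)^{\nu_j+N+1}}\;\delta\Big(z-\prod_{j=1}^n x_j\Big)\,d^2x_1\cdots d^2x_n ,$$ that is, $x_1$ is replaced by $z/(x_2\cdots x_n)$ and the integral is taken over $(x_2,\dots,x_n)\in\mathbb C^{n-1}$ with the Jacobian $|x_2\cdots x_n|^{-2}$, the value being in $[0,\infty]$. Let $$\mathcal P_{n,N}(z_1,\dots,z_N)=\frac1{Z_{n,N}}\prod_{j=1}^N\omega_{n,N}(z_j)\prod_{1\le i<j\le N}|z_i-z_j|^2$$ be the joint probability density on $\mathbb C^N$, where $Z_{n,N}$ is the normalization constant. (It models the eigenvalues of a product of $n$ Cauchy--Lorentz matrices.) Let $\rho_{n,N}(z)=\frac1N\rho_{n,1,N}(z)=\int_{\mathbb C^{N-1}}\mathcal P_{n,N}(z,z_2,\dots,z_N)\,d^2z_2\cdots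 d^2z_N$ be the normalized one-point density. Then for every $z\in\mathbb C$ the limit $$\lim_{N\to\infty}\rho_{n,N}(z)=\rho_{n,\lambda}(z)$$ exists in $[0,\infty]$, and it is finite for $z\ne0$. The function $\rho_{n,\lambda}$ is measurable and rotation invariant, and for all real $s<\frac1n$ $$\int_{\mathbb C}|z|^{2s}\rho_{n,\lambda}(z)\,d^2z=\int_0^1\prod_{i=1}^n\frac{(t+\lambda_i)^s}{(1-t)^s}\,dt ,$$ as an identity in $[0,\infty]$. These moments determine $\rho_{n,\lambda}$: every measurable rotation-invariant function $\mathbb C\to[0,\infty]$ with the same moments for all $s<\frac1n$ equals $\rho_{n,\lambda}$ almost everywhere. In particular, if $\lambda_1=\dots=\lambda_n=0$, then for every $z\in\mathbb C$ $$\rho_{n,0}(z)=\frac1{\pi n}\,\frac{|z|^{\frac{2-2n}{n}}}{\big(1+|z|^{\frac2n}\big)^2},$$ where for $n\ge2$ the right-hand side is read as $+\infty$ at $z=0$. -/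

import Mathlib

open MeasureTheory Filter Topology
open scoped ENNReal

namespace CauchyProduct

noncomputable section

/-- The one-matrix weight `|x|^(2ν) / (1 + |x|²)^(ν + N + 1)` on the complex plane. -/
def factorWeight (N : ℕ) (ν : ℝ) (x : ℂ) : ℝ≥0∞ :=
  ENNReal.ofReal (‖x‖ ^ (2 * ν) / (1 + ‖x‖ ^ 2) ^ (ν + N + 1))

/-- The weight `ω_{n,N}(z) = ∫_{ℂⁿ} ∏ⱼ wⱼ(xⱼ) δ(z - ∏ⱼ xⱼ) d²x₁ ⋯ d²xₙ` for `n = m + 1`, where `wⱼ`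
is the one-matrix weight with parameter `ν j`. The delta function is resolved in the variable with
index `0`: that variable equals `z / ∏ xⱼ` (product over the others), with Jacobian `∏ |xⱼ|⁻²`. -/
def weight {m : ℕ} (N : ℕ) (ν : Fin (m + 1) → ℝ) (z : ℂ) : ℝ≥0∞ :=
  ∫⁻ x : Fin m → ℂ,
    factorWeight N (ν 0) (z / ∏ j, x j) * ∏ j, (factorWeight N (ν j.succ) (x j) / ‖x j‖ₑ ^ 2)

/-- The unnormalized joint density `∏ⱼ ω_{n,N}(zⱼ) ∏_{i<j} |zᵢ - zⱼ|²` of the `N` eigenvalues. -/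
def jointWeight {m : ℕ} (N : ℕ) (ν : Fin (m + 1) → ℝ) (z : Fin N → ℂ) : ℝ≥0∞ :=
  (∏ j, weight N ν (z j)) * ∏ i, ∏ j ∈ Finset.Ioi i, ‖z i - z j‖ₑ ^ 2

/-- The normalization constant of the joint density. -/
def partitionFunction {m : ℕ} (N : ℕ) (ν : Fin (m + 1) → ℝ) : ℝ≥0∞ :=
  ∫⁻ z : Fin N → ℂ, jointWeight N ν z

/-- The joint probability density of the `N` eigenvalues. -/
def jointDensity {m : ℕ} (N : ℕ) (ν : Fin (m + 1) → ℝ) (z : Fin N → ℂ) : ℝ≥0∞ :=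
  jointWeight N ν z / partitionFunction N ν

/-- The `N`-tuple whose first `k` entries are given by `z` and whose last `N - k` ones by `y`. -/
def joinTuple (k N : ℕ) (z : Fin k → ℂ) (y : Fin (N - k) → ℂ) : Fin N → ℂ := fun i =>
  if h : (i : ℕ) < k then z ⟨i, h⟩ else y ⟨i - k, by omega⟩

/-- The `k`-point correlation function: `N! / (N - k)!` times the integral of the joint density over
the last `N - k` eigenvalues. -/
def correlation {m : ℕ} (k N : ℕ) (ν : Fin (m + 1) → ℝ) (z : Fin k → ℂ) : ℝ≥0∞ :=
  (N.descFactorial k : ℝ≥0∞) * ∫⁻ y : Fin (N - k) → ℂ, jointDensity N ν (joinTuple k N z y)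

/-- The normalized eigenvalue density `ρ_{n,N}`: the one-point correlation function over `N`. -/
def eigenvalueDensity {m : ℕ} (N : ℕ) (ν : Fin (m + 1) → ℝ) (z : ℂ) : ℝ≥0∞ :=
  (N : ℝ≥0∞)⁻¹ * correlation 1 N ν (fun _ => z)

/-- `ρ` is a macroscopic density for `λ` (with `n = m + 1`): a measurable rotation-invariant density
on the plane with `∫ |z|^(2s) ρ(z) d²z = ∫₀¹ ∏ᵢ (t + λᵢ)^s / (1 - t)^s dt` for all real `s < 1 / n`.
Both sides are integrals of nonnegative functions, with values in `[0, ∞]`. -/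
structure IsMacroscopicDensity {m : ℕ} (lam : Fin (m + 1) → ℝ) (ρ : ℂ → ℝ≥0∞) : Prop where
  measurable : Measurable ρ
  radial : ∀ z w : ℂ, ‖z‖ = ‖w‖ → ρ z = ρ w
  mellin : ∀ s : ℝ, s < 1 / ((m : ℝ) + 1) →
    ∫⁻ z : ℂ, ‖z‖ₑ ^ (2 * s) * ρ z =
      ∫⁻ t in Set.Ioo (0 : ℝ) 1, ENNReal.ofReal (∏ i, ((t + lam i) ^ s / (1 - t) ^ s))

/-- The function `(1 / (π n)) |z|^((2 - 2 n) / n) / (1 + |z|^(2 / n))²`, with values in `[0, ∞]`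
(its value at `z = 0` is `∞` if `n ≥ 2`). -/
def squareDensity (n : ℕ) (z : ℂ) : ℝ≥0∞ :=
  ENNReal.ofReal (1 / (Real.pi * n)) *
    (‖z‖ₑ ^ ((2 - 2 * (n : ℝ)) / n) / (1 + ‖z‖ₑ ^ (2 / (n : ℝ))) ^ 2)

end

end CauchyProduct

namespace CauchyProduct

/-! The weight ω is rotation invariant, so monomials are orthogonal and the one-point density is N⁻¹
ω(z) ∑_{k<N} |z|^(2k) / H_k, with H_k the integral of |x|^(2k) ω(x) (`eigenvalueDensity_eq`). In the
variable u = log |x|² the multiplicative convolution defining ω becomes an additive convolution of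
kernels e^(au) / (1 + e^u)^M, and H_k becomes a product of their integrals (`weight_mul_exp`,
`lintegral_pow_mul_weight`).

Fix t in (0, 1) and let log |z|² = μ(t) = ∑ log((t + λ_j) / (1 - t)). For degree k ≈ tN the j-th
kernel has its saddle, to leading order, at η_j = log((t + λ_j) / (1 - t)), and the η_j add up to
log |z|². After recentring at η_j and dilating by √N, the exponentially large factors cancel exactly
(`eigenvalueDensity_rescale`). What remains are functions e^f with f concave and f → -x² / (2σ_j),
where σ_j = (1 + λ_j) / ((t + λ_j)(1 - t)). Concavity turns this pointwise convergence into uniform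
domination. The convolution tends to a Gaussian one; the sum over degrees becomes a Riemann sum, on
the scale √N around tN, of a Gaussian with variance 1/S, where S = ∑ σ_j = μ'(t). The two limits
multiply to 1/S (`tendsto_iterConv_mul_sum`).

Hence log |z|² has limiting density 1/μ'(t) at μ(t): it is distributed as μ(t) with t uniform, and
the moment formula is the substitution u = μ(t). At z = 0 there is no saddle, but there the density
is explicit and the same for every N, by a Beta function recurrence (`eigenvalueDensity_zero`).
Uniqueness holds because the moments with s near 0 form a finite Laplace transform of the law of log
|z|², which determines that law (`measure_ext_of_lintegral_exp`). -/

/-! ### The squared Vandermonde determinant and the one-point density -/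

theorem lintegral_fin_prod_eq_prod {n : ℕ} {α : Type*} [MeasureSpace α]
    [SigmaFinite (volume : Measure α)] (f : Fin n → α → ℝ≥0∞) (hf : ∀ i, Measurable (f i)) :
    ∫⁻ x : Fin n → α, ∏ i, f i (x i) = ∏ i, ∫⁻ x, f i x := by
  induction n with
  | zero => simp [volume_pi]
  | succ n ih =>
    rw [← ((volume_preserving_piFinSuccAbove (fun _ => α) 0).symm).lintegral_comp_emb
      (MeasurableEquiv.measurableEmbedding _)]
    simp_rw [MeasurableEquiv.piFinSuccAbove_symm_apply, Fin.insertNthEquiv,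
      Fin.prod_univ_succ, Fin.insertNth_zero, Equiv.coe_fn_mk, Fin.cons_succ, Fin.cons_zero]
    rw [← ih (fun i => f i.succ) (fun i => hf _)]
    change ∫⁻ a : α × (Fin n → α), f 0 a.1 * ∏ i : Fin n, f i.succ (a.2 i)
      ∂(volume.prod volume) = _
    exact lintegral_prod_mul (g := fun y : Fin n → α => ∏ i : Fin n, f i.succ (y i))
      (hf 0).aemeasurable
      (Finset.measurable_prod _ fun i _ => (hf _).comp (measurable_pi_apply i)).aemeasurable

/-- Moves the weights into a product measure, against which products of one-variable functions
integrate factor by factor. -/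
theorem lintegral_prod_mul_eq_lintegral_pi {n : ℕ} {w : ℂ → ℝ≥0∞} (hw : Measurable w)
    [SigmaFinite (volume.withDensity w)] {F : (Fin n → ℂ) → ℝ≥0∞} (hF : Measurable F) :
    ∫⁻ y : Fin n → ℂ, (∏ i, w (y i)) * F y =
      ∫⁻ y, F y ∂(Measure.pi fun _ : Fin n => volume.withDensity w) := by
  have hm : Measurable fun y : Fin n → ℂ => ∏ i, w (y i) :=
    Finset.measurable_prod _ fun i _ => hw.comp (measurable_pi_apply i)
  have : Measure.pi (fun _ : Fin n => volume.withDensity w) =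
      (volume : Measure (Fin n → ℂ)).withDensity (fun y => ∏ i, w (y i)) := by
    refine Measure.pi_eq fun s hs => ?_
    rw [withDensity_apply _ (MeasurableSet.univ_pi hs),
      ← lintegral_indicator (MeasurableSet.univ_pi hs)]
    have : ∀ y : Fin n → ℂ, (Set.pi Set.univ s).indicator (fun y => ∏ i, w (y i)) y =
        ∏ i, (s i).indicator w (y i) := by
      intro y
      by_cases h : y ∈ Set.pi Set.univ s
      · rw [Set.indicator_of_mem h]
        exact Finset.prod_congr rfl fun i _ => (Set.indicator_of_mem (h i trivial) _).symm
      · rw [Set.indicator_of_notMem h]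
        simp only [Set.mem_pi, Set.mem_univ, true_implies, not_forall] at h
        obtain ⟨i, hi⟩ := h
        exact (Finset.prod_eq_zero (Finset.mem_univ i) (Set.indicator_of_notMem hi _)).symm
    simp_rw [this]
    rw [lintegral_fin_prod_eq_prod _ fun i => hw.indicator (hs i)]
    exact Finset.prod_congr rfl fun i _ => by
      rw [lintegral_indicator (hs i), withDensity_apply _ (hs i)]
  rw [this, lintegral_withDensity_eq_lintegral_mul _ hm hF]
  rfl

/-- The squared Vandermonde product. -/
noncomputable def vandermondeSq {n : ℕ} (z : Fin n → ℂ) : ℝ≥0∞ :=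
  ∏ i, ∏ j ∈ Finset.Ioi i, ‖z i - z j‖ₑ ^ 2

theorem measurable_vandermondeSq {n : ℕ} : Measurable (vandermondeSq (n := n)) := by
  unfold vandermondeSq
  fun_prop

theorem vandermondeSq_eq {n : ℕ} (z : Fin n → ℂ) :
    vandermondeSq z = ENNReal.ofReal (‖(Matrix.vandermonde z).det‖ ^ 2) := by
  rw [Matrix.det_vandermonde, ENNReal.ofReal_pow (norm_nonneg _), vandermondeSq]
  simp_rw [Finset.prod_pow, ← ofReal_norm]
  congr 1
  rw [norm_prod, ENNReal.ofReal_prod_of_nonneg (fun _ _ => norm_nonneg _)]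
  refine Finset.prod_congr rfl fun i _ => ?_
  rw [norm_prod, ENNReal.ofReal_prod_of_nonneg (fun _ _ => norm_nonneg _)]
  exact Finset.prod_congr rfl fun j _ => by rw [norm_sub_rev]

theorem det_vandermonde_cons {n : ℕ} (z : ℂ) (y : Fin n → ℂ) :
    (Matrix.vandermonde (Fin.cons z y : Fin (n + 1) → ℂ)).det =
      ∑ σ : Equiv.Perm (Fin (n + 1)), ((Equiv.Perm.sign σ : ℤ) : ℂ) *
        (z ^ (σ 0 : ℕ) * ∏ i : Fin n, y i ^ (σ i.succ : ℕ)) := by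
  rw [← Matrix.det_transpose, Matrix.det_apply']
  simp only [Matrix.transpose_apply, Matrix.vandermonde_apply, Fin.prod_univ_succ, Fin.cons_zero,
    Fin.cons_succ]

/-- The variable with index 0 is not integrated, so orthogonality is available only at the other
indices. This is enough: a bijection of a finite set is determined by all its values but one. -/
theorem perm_ext_succ {n : ℕ} {σ τ : Equiv.Perm (Fin (n + 1))}
    (h : ∀ i : Fin n, σ i.succ = τ i.succ) : σ = τ := by
  have h0 : (τ⁻¹ * σ) 0 = 0 := by
    by_contra hne
    obtain ⟨i, hi⟩ := Fin.exists_succ_eq.2 hne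
    have : (τ⁻¹ * σ) i.succ = i.succ := by simp [h i]
    have := (τ⁻¹ * σ).injective (this.trans hi)
    exact Fin.succ_ne_zero i this
  ext i
  refine Fin.cases ?_ (fun i => by rw [h]) i
  have : σ 0 = τ 0 := by
    have := congrArg τ h0
    simpa using this
  rw [this]

theorem sum_perm_apply_zero {n : ℕ} (g : Fin (n + 1) → ℝ) :
    ∑ σ : Equiv.Perm (Fin (n + 1)), g (σ 0) = (n.factorial : ℝ) * ∑ k, g k := by
  rw [← (Equiv.Perm.decomposeFin (n := n)).symm.sum_comp, Fintype.sum_prod_type]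
  simp [Fintype.card_perm, Finset.mul_sum]

/-- Expanding |det|² by Leibniz gives a double sum over permutations σ, τ; orthogonality in the
integrated variables kills every pair σ ≠ τ. Each value of σ 0 is taken by n! permutations. -/
theorem integral_norm_det_vandermonde_cons {n : ℕ} {κ : Measure ℂ} [SigmaFinite κ] {h : ℕ → ℝ}
    (hint : ∀ a b : ℕ, a < n + 1 → b < n + 1 →
      Integrable (fun x : ℂ => x ^ a * (starRingEnd ℂ) (x ^ b)) κ)
    (horth : ∀ a b : ℕ, a < n + 1 → b < n + 1 →
      ∫ x, x ^ a * (starRingEnd ℂ) (x ^ b) ∂κ = if a = b then (h a : ℂ) else 0)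
    (hpos : ∀ k, k < n + 1 → 0 < h k) (z : ℂ) :
    Integrable (fun y : Fin n → ℂ => ‖(Matrix.vandermonde (Fin.cons z y : Fin (n + 1) → ℂ)).det‖ ^ 2)
      (Measure.pi fun _ : Fin n => κ) ∧
    ∫ y, ‖(Matrix.vandermonde (Fin.cons z y : Fin (n + 1) → ℂ)).det‖ ^ 2
      ∂(Measure.pi fun _ : Fin n => κ) =
      n.factorial * (∏ k : Fin (n + 1), h k) * ∑ k : Fin (n + 1), ‖z‖ ^ (2 * (k : ℕ)) / h k := by
  set P := Equiv.Perm (Fin (n + 1))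
  let c : P → P → ℂ := fun σ τ => ((Equiv.Perm.sign σ : ℤ) : ℂ) * ((Equiv.Perm.sign τ : ℤ) : ℂ) *
    (z ^ (σ 0 : ℕ) * (starRingEnd ℂ) (z ^ (τ 0 : ℕ)))
  let T : P → P → (Fin n → ℂ) → ℂ := fun σ τ y =>
    ∏ i : Fin n, (y i ^ (σ i.succ : ℕ) * (starRingEnd ℂ) (y i ^ (τ i.succ : ℕ)))
  have hexp : ∀ y : Fin n → ℂ,
      ((‖(Matrix.vandermonde (Fin.cons z y : Fin (n + 1) → ℂ)).det‖ ^ 2 : ℝ) : ℂ) =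
        ∑ σ : P, ∑ τ : P, c σ τ * T σ τ y := by
    intro y
    rw [← Complex.normSq_eq_norm_sq, Complex.normSq_eq_conj_mul_self, mul_comm,
      det_vandermonde_cons, map_sum, Finset.sum_mul_sum]
    refine Finset.sum_congr rfl fun σ _ => Finset.sum_congr rfl fun τ _ => ?_
    simp only [map_mul, map_prod, c, T, Finset.prod_mul_distrib, map_intCast]
    ring
  have hTint : ∀ σ τ, Integrable (T σ τ) (Measure.pi fun _ : Fin n => κ) := fun σ τ =>
    Integrable.fintype_prod (f := fun i (x : ℂ) =>
      x ^ (σ (Fin.succ i) : ℕ) * (starRingEnd ℂ) (x ^ (τ (Fin.succ i) : ℕ)))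
      (fun i => hint _ _ (σ _).2 (τ _).2)
  have hTval : ∀ σ τ, ∫ y, T σ τ y ∂(Measure.pi fun _ : Fin n => κ) =
      if σ = τ then ∏ i : Fin n, (h (σ i.succ) : ℂ) else 0 := by
    intro σ τ
    have := integral_fintype_prod_eq_prod (𝕜 := ℂ) (μ := fun _ : Fin n => κ) (fun i (x : ℂ) =>
      x ^ (σ (Fin.succ i) : ℕ) * (starRingEnd ℂ) (x ^ (τ (Fin.succ i) : ℕ)))
    rw [show ∫ y, T σ τ y ∂(Measure.pi fun _ : Fin n => κ) = _ from this]
    split_ifs with hst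
    · subst hst
      exact Finset.prod_congr rfl fun i _ => by rw [horth _ _ (σ _).2 (σ _).2, if_pos rfl]
    · obtain ⟨i, hi⟩ : ∃ i : Fin n, σ i.succ ≠ τ i.succ := by
        by_contra hc
        push Not at hc
        exact hst (perm_ext_succ hc)
      refine Finset.prod_eq_zero (Finset.mem_univ i) ?_
      rw [horth _ _ (σ _).2 (τ _).2, if_neg fun hh => hi (Fin.ext hh)]
  have hcint : Integrable (fun y : Fin n → ℂ =>
      ((‖(Matrix.vandermonde (Fin.cons z y : Fin (n + 1) → ℂ)).det‖ ^ 2 : ℝ) : ℂ))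
      (Measure.pi fun _ : Fin n => κ) := by
    simp_rw [hexp]
    exact integrable_finsetSum _ fun σ _ => integrable_finsetSum _ fun τ _ =>
      (hTint σ τ).const_mul _
  refine ⟨?_, ?_⟩
  · exact hcint.re
  · have : ((∫ y, ‖(Matrix.vandermonde (Fin.cons z y : Fin (n + 1) → ℂ)).det‖ ^ 2
      ∂(Measure.pi fun _ : Fin n => κ) : ℝ) : ℂ) =
      ((∑ σ : P, ((∏ k : Fin (n + 1), h k) * (‖z‖ ^ (2 * (σ 0 : ℕ)) / h (σ 0))) : ℝ) : ℂ) := by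
      rw [← integral_complex_ofReal]
      simp_rw [hexp]
      rw [integral_finsetSum _ fun σ _ => integrable_finsetSum _ fun τ _ =>
        (hTint σ τ).const_mul _]
      rw [Complex.ofReal_sum]
      refine Finset.sum_congr rfl fun σ _ => ?_
      rw [integral_finsetSum _ fun τ _ => (hTint σ τ).const_mul _]
      simp_rw [integral_const_mul, hTval, mul_ite, mul_zero]
      rw [Finset.sum_ite_eq, if_pos (Finset.mem_univ _)]
      -- A diagonal term contains every norm except the one belonging to the free variable, hence
      -- the quotient by h (σ 0).
      have h1 : (∏ k : Fin (n + 1), h k) = h (σ 0) * ∏ i : Fin n, h (σ i.succ) := by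
        rw [← Equiv.prod_comp σ, Fin.prod_univ_succ]
      have h0 : h (σ 0) ≠ 0 := (hpos _ (σ 0).2).ne'
      have h2 : (∏ k : Fin (n + 1), h k) * (‖z‖ ^ (2 * (σ 0 : ℕ)) / h (σ 0)) =
          ‖z‖ ^ (2 * (σ 0 : ℕ)) * ∏ i : Fin n, h (σ i.succ) := by
        rw [h1]; field_simp
      rw [h2]
      simp only [c]
      rw [show ((Equiv.Perm.sign σ : ℤ) : ℂ) * ((Equiv.Perm.sign σ : ℤ) : ℂ) = 1 by
        rw [← Int.cast_mul, ← Units.val_mul, Int.units_mul_self]; simp, one_mul,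
        Complex.mul_conj, Complex.normSq_eq_norm_sq, norm_pow]
      push_cast
      rw [← pow_mul, mul_comm (σ 0 : ℕ) 2]
    have := Complex.ofReal_injective this
    rw [this, sum_perm_apply_zero (fun k => (∏ k : Fin (n + 1), h k) * (‖z‖ ^ (2 * (k : ℕ)) / h k)),
      ← Finset.mul_sum, mul_assoc]

/-- Monomials of different degrees are orthogonal for a rotation invariant weight. -/
theorem integral_pow_mul_conj_pow_eq_zero {w : ℂ → ℝ≥0∞} (hw : Measurable w)
    (hrad : ∀ x y : ℂ, ‖x‖ = ‖y‖ → w x = w y) {a b : ℕ} (hab : a ≠ b) :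
    ∫ x, x ^ a * (starRingEnd ℂ) (x ^ b) ∂(volume.withDensity w) = 0 := by
  have key : ∀ c : Circle, (c : ℂ) ^ a * (starRingEnd ℂ) ((c : ℂ) ^ b) *
      ∫ x, x ^ a * (starRingEnd ℂ) (x ^ b) ∂(volume.withDensity w) =
      ∫ x, x ^ a * (starRingEnd ℂ) (x ^ b) ∂(volume.withDensity w) := by
    intro c
    have hmp : MeasurePreserving (rotation c) (volume : Measure ℂ) volume :=
      (rotation c).measurePreserving
    have hmp' : MeasurePreserving (rotation c) (volume.withDensity w) (volume.withDensity w) := by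
      refine ⟨hmp.measurable, ?_⟩
      ext s hs
      rw [Measure.map_apply hmp.measurable hs, withDensity_apply _ (hmp.measurable hs),
        withDensity_apply _ hs, ← lintegral_indicator hs, ← lintegral_indicator (hmp.measurable hs),
        ← hmp.lintegral_comp (hw.indicator hs)]
      refine lintegral_congr fun x => ?_
      by_cases hx : rotation c x ∈ s
      · rw [Set.indicator_of_mem (show x ∈ rotation c ⁻¹' s from hx), Set.indicator_of_mem hx]
        exact hrad _ _ ((rotation c).norm_map x).symm
      · rw [Set.indicator_of_notMem (show x ∉ rotation c ⁻¹' s from hx),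
          Set.indicator_of_notMem hx]
    rw [← integral_const_mul]
    conv_rhs => rw [← hmp'.integral_comp (rotation c).toHomeomorph.measurableEmbedding]
    refine integral_congr_ae (Eventually.of_forall fun x => ?_)
    simp only [rotation_apply, mul_pow, map_mul]
    ring
  obtain ⟨c, hc⟩ : ∃ c : Circle, (c : ℂ) ^ a * (starRingEnd ℂ) ((c : ℂ) ^ b) ≠ 1 := by
    -- Rotation by one radian separates all degrees: e^(i(a - b)) = 1 with a ≠ b would make π
    -- rational.
    refine ⟨Circle.exp 1, ?_⟩
    rw [Circle.coe_exp, ← Complex.exp_nat_mul, ← Complex.exp_nat_mul, ← Complex.exp_conj,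
      ← Complex.exp_add, Ne, Complex.exp_eq_one_iff]
    rintro ⟨n, hn⟩
    have h1 : ((a : ℂ) - b) = n * (2 * Real.pi) := by
      have hI : (Complex.I) ≠ 0 := Complex.I_ne_zero
      apply mul_right_cancel₀ hI
      simp only [map_mul, map_natCast, Complex.conj_I, Complex.ofReal_one, one_mul] at hn
      linear_combination hn
    have h2 : ((a : ℝ) - b) = n * (2 * Real.pi) := by exact_mod_cast h1
    have hn0 : n ≠ 0 := by
      rintro rfl
      apply hab
      have : (a : ℝ) = b := by simpa [sub_eq_zero] using h2
      exact_mod_cast this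
    apply irrational_pi
    refine ⟨((a : ℚ) - b) / (n * 2), ?_⟩
    push_cast
    rw [h2]
    have : (n : ℝ) ≠ 0 := by exact_mod_cast hn0
    field_simp
  have := key c
  by_contra hne
  exact hc (mul_right_cancel₀ hne (this.trans (one_mul _).symm))

theorem lintegral_vandermondeSq {n : ℕ} {w : ℂ → ℝ≥0∞} (hw : Measurable w)
    (hrad : ∀ x y : ℂ, ‖x‖ = ‖y‖ → w x = w y) {H : ℕ → ℝ≥0∞}
    (hH : ∀ k, H k = ∫⁻ x, ‖x‖ₑ ^ (2 * k) * w x)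
    (h0 : ∀ k, k < n + 1 → H k ≠ 0) (htop : ∀ k, k < n + 1 → H k ≠ ∞) (z : ℂ) :
    ∫⁻ y : Fin n → ℂ, (∏ i, w (y i)) * vandermondeSq (Fin.cons z y : Fin (n + 1) → ℂ) =
      n.factorial * (∏ k : Fin (n + 1), H k) * ∑ k : Fin (n + 1), ‖z‖ₑ ^ (2 * (k : ℕ)) / H k := by
  have hfin : IsFiniteMeasure (volume.withDensity w) := by
    refine isFiniteMeasure_withDensity ?_
    have := htop 0 (Nat.succ_pos n)
    rw [hH] at this
    simpa using this
  have hmeas : Measurable fun y : Fin n → ℂ => vandermondeSq (Fin.cons z y : Fin (n + 1) → ℂ) := by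
    refine measurable_vandermondeSq.comp (measurable_pi_lambda _ fun i => ?_)
    refine Fin.cases ?_ (fun i => ?_) i
    · simp
    · simpa using measurable_pi_apply i
  rw [lintegral_prod_mul_eq_lintegral_pi hw hmeas]
  have hHk : ∀ k, ∫⁻ x, ‖x‖ₑ ^ (2 * k) ∂(volume.withDensity w) = H k := by
    intro k
    rw [lintegral_withDensity_eq_lintegral_mul _ hw (by fun_prop), hH]
    exact lintegral_congr fun x => mul_comm _ _
  have hsq : ∀ k, k < n + 1 → Integrable (fun x : ℂ => ‖x‖ ^ (2 * k)) (volume.withDensity w) := by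
    intro k hk
    refine ⟨by fun_prop, ?_⟩
    rw [hasFiniteIntegral_iff_enorm]
    refine lt_of_eq_of_lt ?_ (htop k hk).lt_top
    rw [← hHk k]
    exact lintegral_congr fun x => by rw [enorm_pow, enorm_norm]
  have hint : ∀ a b : ℕ, a < n + 1 → b < n + 1 →
      Integrable (fun x : ℂ => x ^ a * (starRingEnd ℂ) (x ^ b)) (volume.withDensity w) := by
    intro a b ha hb
    have hm : Measurable fun x : ℂ => x ^ a * (starRingEnd ℂ) (x ^ b) := by
      exact (measurable_id.pow_const a).mul
        (Complex.continuous_conj.measurable.comp (measurable_id.pow_const b))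
    refine ((hsq a ha).add (hsq b hb)).mono' hm.aestronglyMeasurable
      (Eventually.of_forall fun x => ?_)
    simp only [norm_mul, norm_pow, RCLike.norm_conj, Pi.add_apply, pow_mul']
    -- Mixed moments are dominated by even ones: |x|^a |x|^b ≤ |x|^(2a) + |x|^(2b).
    nlinarith [sq_nonneg (‖x‖ ^ a - ‖x‖ ^ b), sq_nonneg (‖x‖ ^ a), sq_nonneg (‖x‖ ^ b)]
  have hval : ∀ k, ∫ x, ‖x‖ ^ (2 * k) ∂(volume.withDensity w) = (H k).toReal := by
    intro k
    rw [integral_eq_lintegral_of_nonneg_ae (Eventually.of_forall fun x => by positivity)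
      (by fun_prop), ← hHk k]
    congr 1
    exact lintegral_congr fun x => by
      rw [ENNReal.ofReal_pow (norm_nonneg _), ofReal_norm]
  have horth : ∀ a b : ℕ, a < n + 1 → b < n + 1 →
      ∫ x, x ^ a * (starRingEnd ℂ) (x ^ b) ∂(volume.withDensity w) =
        if a = b then ((H a).toReal : ℂ) else 0 := by
    intro a b _ _
    split_ifs with hab
    · subst hab
      rw [← hval, ← integral_complex_ofReal]
      refine integral_congr_ae (Eventually.of_forall fun x => ?_)
      simp only [Complex.mul_conj, Complex.normSq_eq_norm_sq, norm_pow, pow_mul']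
    · exact integral_pow_mul_conj_pow_eq_zero hw hrad hab
  have hpos : ∀ k, k < n + 1 → 0 < (H k).toReal := fun k hk =>
    ENNReal.toReal_pos (h0 k hk) (htop k hk)
  obtain ⟨hi, hv⟩ := integral_norm_det_vandermonde_cons (h := fun k => (H k).toReal)
    hint horth hpos z
  simp_rw [vandermondeSq_eq]
  rw [← ofReal_integral_eq_lintegral_ofReal hi (Eventually.of_forall fun y => by positivity), hv,
    ENNReal.ofReal_mul (by positivity), ENNReal.ofReal_mul (by positivity), ENNReal.ofReal_natCast,
    ENNReal.ofReal_prod_of_nonneg fun k _ => ENNReal.toReal_nonneg,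
    ENNReal.ofReal_sum_of_nonneg fun k _ => by positivity]
  congr 1
  · congr 1
    exact Finset.prod_congr rfl fun k _ => ENNReal.ofReal_toReal (htop k k.2)
  · refine Finset.sum_congr rfl fun k _ => ?_
    rw [ENNReal.ofReal_div_of_pos (hpos k k.2), ENNReal.ofReal_toReal (htop k k.2),
      ENNReal.ofReal_pow (norm_nonneg _), ofReal_norm]

theorem measurable_factorWeight (N : ℕ) (ν : ℝ) : Measurable (factorWeight N ν) := by
  unfold factorWeight
  fun_prop

theorem factorWeight_congr (N : ℕ) (ν : ℝ) {x y : ℂ} (h : ‖x‖ = ‖y‖) :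
    factorWeight N ν x = factorWeight N ν y := by
  simp only [factorWeight, h]

theorem measurable_weight {m : ℕ} (N : ℕ) (ν : Fin (m + 1) → ℝ) : Measurable (weight N ν) := by
  unfold weight
  refine Measurable.lintegral_prod_right' (f := fun p : ℂ × (Fin m → ℂ) =>
    factorWeight N (ν 0) (p.1 / ∏ j, p.2 j) *
      ∏ j, (factorWeight N (ν j.succ) (p.2 j) / ‖p.2 j‖ₑ ^ 2)) ?_
  have h := fun j => measurable_factorWeight N (ν j)
  refine ((h 0).comp (by fun_prop)).mul (Finset.measurable_prod _ fun j _ => ?_)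
  exact ((h _).comp (by fun_prop)).div (by fun_prop)

theorem weight_congr {m : ℕ} (N : ℕ) (ν : Fin (m + 1) → ℝ) {x y : ℂ} (h : ‖x‖ = ‖y‖) :
    weight N ν x = weight N ν y := by
  unfold weight
  refine lintegral_congr fun a => ?_
  rw [factorWeight_congr N (ν 0) (y := y / ∏ j, a j) (by rw [norm_div, norm_div, h])]

theorem joinTuple_one (n : ℕ) (z : ℂ) (y : Fin n → ℂ) :
    joinTuple 1 (n + 1) (fun _ => z) y = (Fin.cons z y : Fin (n + 1) → ℂ) := by
  ext i
  refine Fin.cases ?_ (fun i => ?_) i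
  · simp [joinTuple]
  · simp [joinTuple]

theorem jointWeight_cons {m : ℕ} (n : ℕ) (ν : Fin (m + 1) → ℝ) (z : ℂ) (y : Fin n → ℂ) :
    jointWeight (n + 1) ν (Fin.cons z y : Fin (n + 1) → ℂ) = weight (n + 1) ν z *
      ((∏ i, weight (n + 1) ν (y i)) * vandermondeSq (Fin.cons z y : Fin (n + 1) → ℂ)) := by
  rw [jointWeight, Fin.prod_univ_succ, mul_assoc]
  rfl

theorem lintegral_fin_cons {n : ℕ} {F : (Fin (n + 1) → ℂ) → ℝ≥0∞} (hF : Measurable F) :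
    ∫⁻ z, F z = ∫⁻ z : ℂ, ∫⁻ y : Fin n → ℂ, F (Fin.cons z y) := by
  have hmp := (volume_preserving_piFinSuccAbove (fun _ : Fin (n + 1) => ℂ) 0).symm
  rw [← hmp.lintegral_comp hF]
  refine (lintegral_prod _ (hF.comp hmp.measurable).aemeasurable).trans ?_
  simp only [Function.comp_apply, MeasurableEquiv.piFinSuccAbove_symm_apply, Fin.insertNthEquiv,
    Equiv.coe_fn_mk, Fin.insertNth_zero]
  rfl

theorem measurable_jointWeight {m : ℕ} (n : ℕ) (ν : Fin (m + 1) → ℝ) :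
    Measurable (jointWeight n ν) := by
  have h := measurable_weight n ν
  exact (Finset.measurable_prod _ fun i _ => h.comp (measurable_pi_apply i)).mul
    measurable_vandermondeSq

/-- The one-point density as a sum over the orthonormal monomials. -/
theorem eigenvalueDensity_eq {m : ℕ} (n : ℕ) (ν : Fin (m + 1) → ℝ) {H : ℕ → ℝ≥0∞}
    (hH : ∀ k, H k = ∫⁻ x, ‖x‖ₑ ^ (2 * k) * weight (n + 1) ν x)
    (h0 : ∀ k, k < n + 1 → H k ≠ 0) (htop : ∀ k, k < n + 1 → H k ≠ ∞) (z : ℂ) :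
    eigenvalueDensity (n + 1) ν z = ((n + 1 : ℕ) : ℝ≥0∞)⁻¹ *
      (weight (n + 1) ν z * ∑ k ∈ Finset.range (n + 1), ‖z‖ₑ ^ (2 * k) / H k) := by
  have hw := measurable_weight (n + 1) ν
  have hinner : ∀ z : ℂ, ∫⁻ y : Fin n → ℂ,
      jointWeight (n + 1) ν (Fin.cons z y : Fin (n + 1) → ℂ) =
      weight (n + 1) ν z * (n.factorial * (∏ k : Fin (n + 1), H k) *
        ∑ k : Fin (n + 1), ‖z‖ₑ ^ (2 * (k : ℕ)) / H k) := by
    intro z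
    simp_rw [jointWeight_cons]
    rw [lintegral_const_mul, lintegral_vandermondeSq hw (fun x y h => weight_congr _ ν h) hH h0 htop]
    refine (Finset.measurable_prod _ fun i _ => hw.comp (measurable_pi_apply i)).mul ?_
    refine measurable_vandermondeSq.comp (measurable_pi_lambda _ fun i => ?_)
    refine Fin.cases ?_ (fun i => ?_) i
    · simp
    · simpa using measurable_pi_apply i
  set P : ℝ≥0∞ := ∏ k : Fin (n + 1), H k with hP
  have hP0 : P ≠ 0 := Finset.prod_ne_zero_iff.2 fun k _ => h0 k k.2
  have hPt : P ≠ ∞ := ENNReal.prod_ne_top fun k _ => htop k k.2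
  -- Each of the n + 1 normalized monomials has integral 1 against the weight, which gives the
  -- factor n + 1.
  have hZ : partitionFunction (n + 1) ν = (n.factorial * P) * (n + 1 : ℕ) := by
    rw [partitionFunction, lintegral_fin_cons (measurable_jointWeight _ ν)]
    simp_rw [hinner]
    have : ∀ z : ℂ, weight (n + 1) ν z * (n.factorial * P *
        ∑ k : Fin (n + 1), ‖z‖ₑ ^ (2 * (k : ℕ)) / H k) =
        (n.factorial * P) * ∑ k : Fin (n + 1),
          (‖z‖ₑ ^ (2 * (k : ℕ)) * weight (n + 1) ν z) * (H k)⁻¹ := by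
      intro z
      rw [mul_left_comm, Finset.mul_sum]
      congr 1
      refine Finset.sum_congr rfl fun k _ => ?_
      rw [div_eq_mul_inv]; ring
    simp_rw [this]
    rw [lintegral_const_mul _ (by fun_prop), lintegral_finsetSum _ (by fun_prop)]
    congr 1
    rw [Finset.sum_congr rfl (g := fun _ => (1 : ℝ≥0∞))]
    · simp
    · intro k _
      rw [lintegral_mul_const _ (by fun_prop), ← hH, ENNReal.mul_inv_cancel (h0 k k.2) (htop k k.2)]
  have hf0 : (n.factorial : ℝ≥0∞) ≠ 0 := by exact_mod_cast n.factorial_ne_zero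
  have hft : (n.factorial : ℝ≥0∞) ≠ ∞ := ENNReal.natCast_ne_top _
  have hn0 : ((n + 1 : ℕ) : ℝ≥0∞) ≠ 0 := by exact_mod_cast n.succ_ne_zero
  have hnt : ((n + 1 : ℕ) : ℝ≥0∞) ≠ ∞ := ENNReal.natCast_ne_top _
  have hA0 : (n.factorial * P : ℝ≥0∞) ≠ 0 := mul_ne_zero hf0 hP0
  have hAt : (n.factorial * P : ℝ≥0∞) ≠ ∞ := ENNReal.mul_ne_top hft hPt
  have hint : ∫⁻ y : Fin (n + 1 - 1) → ℂ, jointDensity (n + 1) ν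
      (joinTuple 1 (n + 1) (fun _ => z) y) =
      (∫⁻ y : Fin n → ℂ, jointWeight (n + 1) ν (Fin.cons z y : Fin (n + 1) → ℂ)) *
        (partitionFunction (n + 1) ν)⁻¹ := by
    rw [← lintegral_mul_const']
    · refine lintegral_congr fun y => ?_
      rw [jointDensity, joinTuple_one, div_eq_mul_inv]
    · rw [hZ]
      exact ENNReal.inv_ne_top.2 (mul_ne_zero hA0 hn0)
  rw [eigenvalueDensity, correlation, hint, hinner, hZ, Nat.descFactorial_one, ← mul_assoc,
    ENNReal.inv_mul_cancel hn0 hnt, one_mul, ENNReal.mul_inv (Or.inl hA0) (Or.inl hAt),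
    Finset.sum_range (fun k => ‖z‖ₑ ^ (2 * k) / H k)]
  set S := ∑ k : Fin (n + 1), ‖z‖ₑ ^ (2 * (k : ℕ)) / H k
  set A : ℝ≥0∞ := n.factorial * P
  calc weight (n + 1) ν z * (A * S) * (A⁻¹ * ((n + 1 : ℕ) : ℝ≥0∞)⁻¹)
      = (A * A⁻¹) * (((n + 1 : ℕ) : ℝ≥0∞)⁻¹ * (weight (n + 1) ν z * S)) := by ring
    _ = _ := by rw [ENNReal.mul_inv_cancel hA0 hAt, one_mul]

/-! ### Logarithmic coordinates: the weight as an additive convolution -/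

/-- Integration of a radial function in the variable `u = log |x|²`. -/
theorem lintegral_norm_eq {f : ℝ → ℝ≥0∞} (hf : Measurable f) :
    ∫⁻ x : ℂ, f ‖x‖ = ENNReal.ofReal Real.pi *
      ∫⁻ u : ℝ, ENNReal.ofReal (Real.exp u) * f (Real.exp (u / 2)) := by
  rw [← Complex.lintegral_comp_polarCoord_symm]
  have h1 : ∀ p ∈ polarCoord.target, ENNReal.ofReal p.1 • f ‖Complex.polarCoord.symm p‖ =
      (ENNReal.ofReal p.1 * f p.1) * 1 := by
    intro p hp
    rw [Complex.norm_polarCoord_symm, abs_of_pos hp.1, smul_eq_mul, mul_one]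
  rw [setLIntegral_congr_fun polarCoord.open_target.measurableSet h1, polarCoord_target,
    Measure.volume_eq_prod, ← Measure.prod_restrict,
    lintegral_prod_mul (f := fun r => ENNReal.ofReal r * f r) (g := fun _ => 1) (by fun_prop)
      (by fun_prop)]
  have himg : (fun u : ℝ => Real.exp (u / 2)) '' Set.univ = Set.Ioi 0 := by
    ext r
    constructor
    · rintro ⟨u, -, rfl⟩
      exact Real.exp_pos _
    · intro hr
      exact ⟨2 * Real.log r, trivial, by
        simp only [mul_div_cancel_left₀ _ (two_ne_zero' ℝ)]
        exact Real.exp_log hr⟩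
  rw [← himg, lintegral_image_eq_lintegral_abs_deriv_mul MeasurableSet.univ
    (f' := fun u => Real.exp (u / 2) * (1 / 2))]
  · have : ∀ u : ℝ, ENNReal.ofReal |Real.exp (u / 2) * (1 / 2)| *
        (ENNReal.ofReal (Real.exp (u / 2)) * f (Real.exp (u / 2))) =
        ENNReal.ofReal (1 / 2) * (ENNReal.ofReal (Real.exp u) * f (Real.exp (u / 2))) := by
      intro u
      rw [abs_of_nonneg (by positivity), ← mul_assoc, ← mul_assoc,
        ← ENNReal.ofReal_mul (by positivity), ← ENNReal.ofReal_mul (by positivity)]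
      congr 2
      have : Real.exp u = Real.exp (u / 2) * Real.exp (u / 2) := by
        rw [← Real.exp_add]; congr 1; ring
      rw [this]; ring
    simp_rw [this]
    rw [Measure.restrict_univ, lintegral_const_mul _ (by fun_prop), setLIntegral_one,
      Real.volume_Ioo, mul_right_comm, ← ENNReal.ofReal_mul (by positivity)]
    congr 2
    ring
  · intro u _
    have := ((hasDerivAt_id u).div_const 2).exp
    exact this.hasDerivWithinAt
  · intro a _ b _ hab
    have := Real.exp_injective hab
    linarith

/-- The function `e^(a u) / (1 + e^u)^M`. -/
noncomputable def expKernel (a M u : ℝ) : ℝ≥0∞ :=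
  ENNReal.ofReal (Real.exp (a * u - M * Real.log (1 + Real.exp u)))

theorem measurable_expKernel (a M : ℝ) : Measurable (expKernel a M) := by
  unfold expKernel
  fun_prop

theorem exp_mul_expKernel (κ a M u : ℝ) :
    ENNReal.ofReal (Real.exp (κ * u)) * expKernel a M u = expKernel (a + κ) M u := by
  rw [expKernel, expKernel, ← ENNReal.ofReal_mul (by positivity), ← Real.exp_add]
  congr 2
  ring

theorem factorWeight_exp (N : ℕ) (ν u : ℝ) :
    factorWeight N ν (Real.exp (u / 2) : ℂ) = expKernel ν (ν + N + 1) u := by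
  rw [factorWeight, expKernel]
  congr 1
  rw [Complex.norm_real, Real.norm_of_nonneg (by positivity), ← Real.exp_mul, ← Real.exp_nat_mul,
    Real.exp_sub]
  have h : (0 : ℝ) < 1 + Real.exp u := by positivity
  congr 1
  · congr 1; ring_nf
  · rw [Real.rpow_def_of_pos (by positivity), mul_comm (Real.log _)]
    congr 4
    ring_nf

/-- Peeling off the last variable, and not the one in which the delta function is resolved, exhibits
the weight as a multiplicative convolution with a weight of the same form, so induction on m
applies. -/
theorem weight_succ {m : ℕ} (N : ℕ) (ν : Fin (m + 2) → ℝ) (z : ℂ) :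
    weight N ν z = ∫⁻ x : ℂ, factorWeight N (ν (Fin.last _)) x / ‖x‖ₑ ^ 2 *
      weight N (fun i => ν i.castSucc) (z / x) := by
  have hmp := (volume_preserving_piFinSuccAbove (fun _ : Fin (m + 1) => ℂ) (Fin.last m)).symm
  have hf := fun j => measurable_factorWeight N (ν j)
  have hmeas : Measurable fun x : Fin (m + 1) → ℂ => factorWeight N (ν 0) (z / ∏ j, x j) *
      ∏ j, (factorWeight N (ν j.succ) (x j) / ‖x j‖ₑ ^ 2) := by
    refine ((hf 0).comp (by fun_prop)).mul (Finset.measurable_prod _ fun j _ => ?_)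
    exact ((hf _).comp (by fun_prop)).div (by fun_prop)
  rw [weight, ← hmp.lintegral_comp hmeas]
  refine (lintegral_prod _ (hmeas.comp hmp.measurable).aemeasurable).trans ?_
  refine lintegral_congr fun x => ?_
  rw [weight, ← lintegral_const_mul]
  · refine lintegral_congr fun y => ?_
    simp only [Function.comp_apply, MeasurableEquiv.piFinSuccAbove_symm_apply, Fin.insertNthEquiv, Equiv.coe_fn_mk,
      Fin.insertNth_last', Fin.prod_univ_castSucc, Fin.snoc_castSucc, Fin.snoc_last,
      Fin.succ_last, Fin.castSucc_zero, Fin.succ_castSucc]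
    rw [show z / ((∏ i, y i) * x) = z / x / ∏ i, y i by rw [mul_comm, div_div]]
    ring
  · refine ((hf _).comp (by fun_prop)).mul (Finset.measurable_prod _ fun j _ => ?_)
    exact ((hf _).comp (by fun_prop)).div (by fun_prop)

/-- The iterated convolution of finitely many functions on the line. -/
noncomputable def iterConv : (m : ℕ) → (Fin (m + 1) → ℝ → ℝ≥0∞) → ℝ → ℝ≥0∞
  | 0, φ => φ 0
  | m + 1, φ => fun y => ∫⁻ u, φ (Fin.last _) u * iterConv m (fun i => φ i.castSucc) (y - u)

theorem measurable_iterConv {m : ℕ} {φ : Fin (m + 1) → ℝ → ℝ≥0∞} (hφ : ∀ i, Measurable (φ i)) :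
    Measurable (iterConv m φ) := by
  induction m with
  | zero => exact hφ 0
  | succ m ih =>
    have h1 := hφ (Fin.last _)
    have h2 := ih (φ := fun i => φ i.castSucc) fun i => hφ _
    exact Measurable.lintegral_prod_right' (f := fun p : ℝ × ℝ =>
      φ (Fin.last _) p.2 * iterConv m (fun i => φ i.castSucc) (p.1 - p.2)) (by fun_prop)

theorem lintegral_iterConv {m : ℕ} {φ : Fin (m + 1) → ℝ → ℝ≥0∞} (hφ : ∀ i, Measurable (φ i)) :
    ∫⁻ y, iterConv m φ y = ∏ i, ∫⁻ u, φ i u := by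
  induction m with
  | zero => simp [iterConv]
  | succ m ih =>
    have h1 := hφ (Fin.last _)
    have h2 := measurable_iterConv (φ := fun i : Fin (m + 1) => φ i.castSucc) fun i => hφ _
    rw [Fin.prod_univ_castSucc, ← ih (φ := fun i => φ i.castSucc) fun i => hφ _]
    simp only [iterConv]
    rw [lintegral_lintegral_swap (by fun_prop)]
    have : ∀ u : ℝ, ∫⁻ y, φ (Fin.last _) u * iterConv m (fun i => φ i.castSucc) (y - u) =
        φ (Fin.last _) u * ∫⁻ y, iterConv m (fun i => φ i.castSucc) y := by
      intro u
      rw [lintegral_const_mul _ (by fun_prop), lintegral_sub_right_eq_self]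
    simp_rw [this]
    rw [lintegral_mul_const _ h1, mul_comm]

theorem lintegral_comp_affine {f : ℝ → ℝ≥0∞} (hf : Measurable f) (η : ℝ) {ε : ℝ} (hε : 0 < ε) :
    ∫⁻ u, f u = ENNReal.ofReal ε * ∫⁻ x, f (η + ε * x) := by
  have himg : (fun x : ℝ => η + ε * x) '' Set.univ = Set.univ :=
    Set.eq_univ_of_forall fun y => ⟨(y - η) / ε, trivial, by field_simp; ring⟩
  rw [← setLIntegral_univ, ← himg, lintegral_image_eq_lintegral_abs_deriv_mul MeasurableSet.univ
    (f' := fun _ => ε)]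
  · rw [abs_of_pos hε, Measure.restrict_univ, lintegral_const_mul _ (by fun_prop)]
  · intro x _
    exact ((((hasDerivAt_id x).const_mul ε).const_add η).congr_deriv (mul_one ε)).hasDerivWithinAt
  · intro a _ b _ hab
    simpa [hε.ne'] using hab

/-- An exponential tilt passes through a convolution because e^(κx) = e^(κu) e^(κ(x - u)), and each
of the m integrations costs one Jacobian ε. Used with ε = 1, κ = k for the moments and with ε =
1/√N, κ = -k/√N for recentring at the saddle points. -/
theorem iterConv_rescale {m : ℕ} {φ ψ : Fin (m + 1) → ℝ → ℝ≥0∞} (hφ : ∀ i, Measurable (φ i))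
    (hψ : ∀ i, Measurable (ψ i)) {η : Fin (m + 1) → ℝ} {c : Fin (m + 1) → ℝ≥0∞} {ε κ : ℝ}
    (hε : 0 < ε)
    (h : ∀ i x, φ i (η i + ε * x) = c i * (ENNReal.ofReal (Real.exp (κ * x)) * ψ i x)) (x : ℝ) :
    iterConv m φ (∑ i, η i + ε * x) = ENNReal.ofReal ε ^ m * (∏ i, c i) *
      (ENNReal.ofReal (Real.exp (κ * x)) * iterConv m ψ x) := by
  induction m generalizing x with
  | zero => simp [iterConv, h]
  | succ m ih =>
    have h1 := hφ (Fin.last _)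
    have h2 := measurable_iterConv (φ := fun i : Fin (m + 1) => φ i.castSucc) fun i => hφ _
    have h3 := hψ (Fin.last _)
    have h4 := measurable_iterConv (φ := fun i : Fin (m + 1) => ψ i.castSucc) fun i => hψ _
    have key := ih (φ := fun i => φ i.castSucc) (ψ := fun i => ψ i.castSucc)
      (η := fun i => η i.castSucc) (c := fun i => c i.castSucc) (fun i => hφ _) (fun i => hψ _)
      fun i x => h _ x
    simp only [iterConv]
    rw [lintegral_comp_affine (by fun_prop) (η (Fin.last _)) hε]
    have : ∀ u : ℝ, φ (Fin.last _) (η (Fin.last _) + ε * u) *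
        iterConv m (fun i => φ i.castSucc) (∑ i, η i + ε * x - (η (Fin.last _) + ε * u)) =
        (ENNReal.ofReal ε ^ m * (∏ i, c i) * ENNReal.ofReal (Real.exp (κ * x))) *
          (ψ (Fin.last _) u * iterConv m (fun i => ψ i.castSucc) (x - u)) := by
      intro u
      rw [Fin.sum_univ_castSucc, Fin.prod_univ_castSucc,
        show ∑ i : Fin (m + 1), η i.castSucc + η (Fin.last _) + ε * x - (η (Fin.last _) + ε * u) =
          ∑ i : Fin (m + 1), η i.castSucc + ε * (x - u) by ring, key, h,
        show Real.exp (κ * x) = Real.exp (κ * u) * Real.exp (κ * (x - u)) by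
          rw [← Real.exp_add]; congr 1; ring, ENNReal.ofReal_mul (by positivity)]
      ring
    simp_rw [this]
    rw [lintegral_const_mul _ (by fun_prop)]
    ring

/-- The factor e^y is the Jacobian of y = log |z|². It splits as e^u e^(y - u), which supplies each
kernel with its own Jacobian; each of the m angular integrations contributes π. -/
theorem weight_mul_exp {m : ℕ} (N : ℕ) (ν : Fin (m + 1) → ℝ) (y : ℝ) :
    weight N ν (Real.exp (y / 2) : ℂ) * ENNReal.ofReal (Real.exp y) =
      ENNReal.ofReal Real.pi ^ m * iterConv m (fun j => expKernel (ν j + 1) (ν j + N + 1)) y := by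
  induction m generalizing y with
  | zero =>
    have : weight N ν (Real.exp (y / 2) : ℂ) = factorWeight N (ν 0) (Real.exp (y / 2) : ℂ) := by
      simp [weight, volume_pi]
    rw [this, factorWeight_exp, mul_comm]
    simpa [iterConv] using exp_mul_expKernel 1 (ν 0) (ν 0 + N + 1) y
  | succ m ih =>
    have hw := measurable_weight N (fun i : Fin (m + 1) => ν i.castSucc)
    have hf := measurable_factorWeight N (ν (Fin.last _))
    have hi := measurable_iterConv
      (φ := fun j : Fin (m + 1) => expKernel (ν j.castSucc + 1) (ν j.castSucc + N + 1))
      fun i => measurable_expKernel _ _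
    have hk := measurable_expKernel (ν (Fin.last _) + 1) (ν (Fin.last _) + N + 1)
    rw [weight_succ]
    let f : ℝ → ℝ≥0∞ := fun r => factorWeight N (ν (Fin.last _)) (r : ℂ) / ‖r‖ₑ ^ 2 *
      weight N (fun i => ν i.castSucc) ((Real.exp (y / 2) : ℂ) / (r : ℂ))
    have h1 : ∀ x : ℂ, factorWeight N (ν (Fin.last _)) x / ‖x‖ₑ ^ 2 *
        weight N (fun i => ν i.castSucc) ((Real.exp (y / 2) : ℂ) / x) = f ‖x‖ := by
      intro x
      simp only [enorm_norm, f]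
      rw [factorWeight_congr N _ (x := x) (y := (‖x‖ : ℂ)) (by simp),
        weight_congr N _ (x := (Real.exp (y / 2) : ℂ) / x)
          (y := (Real.exp (y / 2) : ℂ) / (‖x‖ : ℂ)) (by simp)]
    have hfm : Measurable f := by fun_prop
    rw [lintegral_congr h1, lintegral_norm_eq hfm, mul_assoc, ← lintegral_mul_const _ (by fun_prop)]
    have h2 : ∀ u : ℝ, ENNReal.ofReal (Real.exp u) *
        (factorWeight N (ν (Fin.last _)) (Real.exp (u / 2) : ℂ) / ‖Real.exp (u / 2)‖ₑ ^ 2 *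
          weight N (fun i => ν i.castSucc)
            ((Real.exp (y / 2) : ℂ) / (Real.exp (u / 2) : ℂ))) * ENNReal.ofReal (Real.exp y) =
        ENNReal.ofReal Real.pi ^ m * (expKernel (ν (Fin.last _) + 1) (ν (Fin.last _) + N + 1) u *
          iterConv m (fun j => expKernel (ν j.castSucc + 1) (ν j.castSucc + N + 1)) (y - u)) := by
      intro u
      have hdiv : (Real.exp (y / 2) : ℂ) / (Real.exp (u / 2) : ℂ) =
          (Real.exp ((y - u) / 2) : ℂ) := by
        rw [← Complex.ofReal_div, ← Real.exp_sub]
        congr 2; ring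
      have hsq : ‖Real.exp (u / 2)‖ₑ ^ 2 = ENNReal.ofReal (Real.exp u) := by
        rw [Real.enorm_of_nonneg (by positivity), ← ENNReal.ofReal_pow (by positivity),
          ← Real.exp_nat_mul]
        congr 2; push_cast; ring
      have hy : ENNReal.ofReal (Real.exp y) =
          ENNReal.ofReal (Real.exp u) * ENNReal.ofReal (Real.exp (y - u)) := by
        rw [← ENNReal.ofReal_mul (by positivity), ← Real.exp_add]
        congr 2; ring
      have hne : ENNReal.ofReal (Real.exp u) ≠ 0 := by simp [Real.exp_pos]
      have hk1 : ENNReal.ofReal (Real.exp u) * expKernel (ν (Fin.last _)) (ν (Fin.last _) + N + 1) u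
          = expKernel (ν (Fin.last _) + 1) (ν (Fin.last _) + N + 1) u := by
        simpa using exp_mul_expKernel 1 (ν (Fin.last _)) (ν (Fin.last _) + N + 1) u
      rw [hdiv, hsq, factorWeight_exp, hy, mul_left_comm (ENNReal.ofReal Real.pi ^ m), ← ih, ← hk1, div_eq_mul_inv]
      set E := ENNReal.ofReal (Real.exp u)
      have hc : E * E⁻¹ = 1 := ENNReal.mul_inv_cancel hne ENNReal.ofReal_ne_top
      calc _ = (E * E⁻¹) * (expKernel (ν (Fin.last _)) (ν (Fin.last _) + N + 1) u *
            (E * (weight N (fun i => ν i.castSucc) (Real.exp ((y - u) / 2) : ℂ) *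
            ENNReal.ofReal (Real.exp (y - u))))) := by ring
        _ = _ := by rw [hc]; ring
    simp only [f, h2]
    rw [lintegral_const_mul _ (by fun_prop)]
    simp only [iterConv]
    ring

/-- The factor |x|^(2k) is a tilt e^(ku) that distributes over the convolution factors, and the mass
of a convolution is the product of the masses. -/
theorem lintegral_pow_mul_weight {m : ℕ} (N : ℕ) (ν : Fin (m + 1) → ℝ) (k : ℕ) :
    ∫⁻ x : ℂ, ‖x‖ₑ ^ (2 * k) * weight N ν x = ENNReal.ofReal Real.pi ^ (m + 1) *
      ∏ j, ∫⁻ u, expKernel (ν j + 1 + k) (ν j + N + 1) u := by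
  have hw := measurable_weight N ν
  let f : ℝ → ℝ≥0∞ := fun r => ‖r‖ₑ ^ (2 * k) * weight N ν (r : ℂ)
  have h1 : ∀ x : ℂ, ‖x‖ₑ ^ (2 * k) * weight N ν x = f ‖x‖ := by
    intro x
    simp only [enorm_norm, f]
    rw [weight_congr N ν (x := x) (y := (‖x‖ : ℂ)) (by simp)]
  have hfm : Measurable f := by fun_prop
  rw [lintegral_congr h1, lintegral_norm_eq hfm]
  have hmi := measurable_iterConv (φ := fun j => expKernel (ν j + 1 + k) (ν j + N + 1))
    fun i => measurable_expKernel _ _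
  have h2 : ∀ u : ℝ, ENNReal.ofReal (Real.exp u) *
      (‖Real.exp (u / 2)‖ₑ ^ (2 * k) * weight N ν (Real.exp (u / 2) : ℂ)) =
      ENNReal.ofReal Real.pi ^ m *
        iterConv m (fun j => expKernel (ν j + 1 + k) (ν j + N + 1)) u := by
    intro u
    have := iterConv_rescale (φ := fun j => expKernel (ν j + 1 + k) (ν j + N + 1))
      (ψ := fun j => expKernel (ν j + 1) (ν j + N + 1)) (η := fun _ => 0) (c := fun _ => 1)
      (ε := 1) (κ := k) (fun i => measurable_expKernel _ _) (fun i => measurable_expKernel _ _)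
      one_pos (fun i x => by rw [exp_mul_expKernel]; simp) u
    simp only [Finset.sum_const_zero, zero_add, one_mul, ENNReal.ofReal_one, one_pow,
      Finset.prod_const_one] at this
    rw [this, mul_left_comm (ENNReal.ofReal Real.pi ^ m), ← weight_mul_exp, Real.enorm_of_nonneg (by positivity),
      ← ENNReal.ofReal_pow (by positivity), ← Real.exp_nat_mul,
      show ((2 * k : ℕ) : ℝ) * (u / 2) = k * u by push_cast; ring]
    ring
  simp only [f, h2]
  rw [lintegral_const_mul _ hmi, lintegral_iterConv fun i => measurable_expKernel _ _]
  ring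

/-! ### Beta integrals of the kernels and the weight at the origin -/

theorem integrable_exp_neg_mul_abs {c : ℝ} (hc : 0 < c) :
    Integrable fun x : ℝ => Real.exp (-(c * |x|)) := by
  have h1 : IntegrableOn (fun x : ℝ => Real.exp (-(c * |x|))) (Set.Iic 0) := by
    refine (integrableOn_exp_mul_Iic hc 0).congr_fun (fun x hx => ?_) measurableSet_Iic
    simp only [abs_of_nonpos (Set.mem_Iic.1 hx), mul_neg, neg_neg]
  have h2 : IntegrableOn (fun x : ℝ => Real.exp (-(c * |x|))) (Set.Ioi 0) := by
    refine (exp_neg_integrableOn_Ioi 0 hc).congr_fun (fun x hx => ?_) measurableSet_Ioi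
    simp only [abs_of_pos (Set.mem_Ioi.1 hx), neg_mul]
  have := h1.union h2
  rwa [Set.Iic_union_Ioi, integrableOn_univ] at this

theorem lintegral_exp_sub_mul_abs_ne_top (C : ℝ) {c : ℝ} (hc : 0 < c) :
    ∫⁻ x : ℝ, ENNReal.ofReal (Real.exp (C - c * |x|)) ≠ ∞ := by
  have h := ((integrable_exp_neg_mul_abs hc).const_mul (Real.exp C)).lintegral_lt_top.ne
  convert h using 4 with x
  rw [← Real.exp_add, sub_eq_add_neg]

theorem log_one_add_exp_nonneg (u : ℝ) : 0 ≤ Real.log (1 + Real.exp u) :=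
  Real.log_nonneg (by linarith [Real.exp_pos u])

theorem le_log_one_add_exp (u : ℝ) : u ≤ Real.log (1 + Real.exp u) := by
  rw [Real.le_log_iff_exp_le (by positivity)]
  linarith

theorem hasDerivAt_log_one_add_exp (u : ℝ) : HasDerivAt (fun u => Real.log (1 + Real.exp u))
    (Real.exp u / (1 + Real.exp u)) u :=
  ((Real.hasDerivAt_exp u).const_add 1).log (by positivity)

/-- Both bounds log(1 + e^u) ≥ 0 and log(1 + e^u) ≥ u are used, one on each half-line. -/
theorem mul_sub_mul_log_le {a M : ℝ} (ha : 0 < a) (haM : a < M) (u : ℝ) :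
    a * u - M * Real.log (1 + Real.exp u) ≤ 0 - min a (M - a) * |u| := by
  have h1 := log_one_add_exp_nonneg u
  have h2 := le_log_one_add_exp u
  have h3 := min_le_left a (M - a)
  have h4 := min_le_right a (M - a)
  rcases le_total 0 u with hu | hu
  · rw [abs_of_nonneg hu]
    nlinarith
  · rw [abs_of_nonpos hu]
    nlinarith

theorem lintegral_expKernel_ne_top {a M : ℝ} (ha : 0 < a) (haM : a < M) :
    ∫⁻ u, expKernel a M u ≠ ∞ := by
  refine ne_top_of_le_ne_top
    (lintegral_exp_sub_mul_abs_ne_top 0 (lt_min ha (sub_pos.2 haM))) (lintegral_mono fun u => ?_)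
  exact ENNReal.ofReal_le_ofReal (Real.exp_le_exp.2 (mul_sub_mul_log_le ha haM u))

theorem lintegral_expKernel_ne_zero (a M : ℝ) : ∫⁻ u, expKernel a M u ≠ 0 := by
  intro h
  rw [lintegral_eq_zero_iff (measurable_expKernel a M)] at h
  obtain ⟨u, hu⟩ := h.exists
  simp only [expKernel, Pi.zero_apply, ENNReal.ofReal_eq_zero] at hu
  exact absurd (Real.exp_pos _) (not_lt.2 hu)

theorem integrable_exp_kernel {a M : ℝ} (ha : 0 < a) (haM : a < M) :
    Integrable fun u => Real.exp (a * u - M * Real.log (1 + Real.exp u)) := by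
  refine ⟨by fun_prop, ?_⟩
  rw [hasFiniteIntegral_iff_ofReal (Eventually.of_forall fun u => by positivity)]
  exact (lintegral_expKernel_ne_top ha haM).lt_top

theorem lintegral_expKernel_eq {a M : ℝ} (ha : 0 < a) (haM : a < M) :
    ∫⁻ u, expKernel a M u =
      ENNReal.ofReal (∫ u, Real.exp (a * u - M * Real.log (1 + Real.exp u))) := by
  rw [ofReal_integral_eq_lintegral_ofReal (integrable_exp_kernel ha haM)
    (Eventually.of_forall fun u => by positivity)]
  rfl

theorem hasDerivAt_exp_kernel (a M u : ℝ) :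
    HasDerivAt (fun u => Real.exp (a * u - M * Real.log (1 + Real.exp u)))
      (a * Real.exp (a * u - (M + 1) * Real.log (1 + Real.exp u)) -
        (M - a) * Real.exp ((a + 1) * u - (M + 1) * Real.log (1 + Real.exp u))) u := by
  have h := (((hasDerivAt_id u).const_mul a).sub
    ((hasDerivAt_log_one_add_exp u).const_mul M)).exp
  refine h.congr_deriv ?_
  have hp : (0 : ℝ) < 1 + Real.exp u := by positivity
  have h1 : Real.exp (a * u - (M + 1) * Real.log (1 + Real.exp u)) =
      Real.exp (a * u - M * Real.log (1 + Real.exp u)) / (1 + Real.exp u) := by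
    rw [← Real.exp_log hp, ← Real.exp_sub, Real.exp_log hp]
    congr 1; ring
  have h2 : Real.exp ((a + 1) * u - (M + 1) * Real.log (1 + Real.exp u)) =
      Real.exp (a * u - M * Real.log (1 + Real.exp u)) * Real.exp u / (1 + Real.exp u) := by
    rw [← Real.exp_add, ← Real.exp_log hp, ← Real.exp_sub, Real.exp_log hp]
    congr 1; ring
  rw [h1, h2]
  simp only [Pi.sub_apply, id]
  field_simp
  ring

theorem tendsto_log_one_add_exp_atBot :
    Tendsto (fun u : ℝ => Real.log (1 + Real.exp u)) atBot (𝓝 0) := by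
  have h : Tendsto (fun u : ℝ => 1 + Real.exp u) atBot (𝓝 1) := by
    simpa using Real.tendsto_exp_atBot.const_add 1
  simpa using h.log one_ne_zero

theorem tendsto_exp_kernel_atBot {a : ℝ} (ha : 0 < a) (M : ℝ) :
    Tendsto (fun u => Real.exp (a * u - M * Real.log (1 + Real.exp u))) atBot (𝓝 0) := by
  refine Real.tendsto_exp_atBot.comp ?_
  simp_rw [sub_eq_add_neg]
  refine Tendsto.atBot_add (C := -(M * 0)) (tendsto_id.const_mul_atBot ha) ?_
  exact (tendsto_log_one_add_exp_atBot.const_mul M).neg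

theorem tendsto_exp_kernel_atTop {a M : ℝ} (hM : 0 ≤ M) (haM : a < M) :
    Tendsto (fun u => Real.exp (a * u - M * Real.log (1 + Real.exp u))) atTop (𝓝 0) := by
  refine Real.tendsto_exp_atBot.comp ?_
  refine tendsto_atBot_mono (fun u => ?_)
    ((tendsto_id (α := ℝ)).const_mul_atTop_of_neg (r := a - M) (by linarith))
  simp only [id]
  nlinarith [le_log_one_add_exp u]

/-- This is a B(a, M + 1 - a) = (M - a) B(a + 1, M - a): the derivative of e^(au) / (1 + e^u)^M
integrates to zero. It evaluates the density at the origin. -/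
theorem lintegral_expKernel_recurrence {a M : ℝ} (ha : 0 < a) (haM : a < M) :
    ENNReal.ofReal a * ∫⁻ u, expKernel a (M + 1) u =
      ENNReal.ofReal (M - a) * ∫⁻ u, expKernel (a + 1) (M + 1) u := by
  have h1 := integrable_exp_kernel ha (show a < M + 1 by linarith)
  have h2 := integrable_exp_kernel (show 0 < a + 1 by linarith) (show a + 1 < M + 1 by linarith)
  have h := integral_of_hasDerivAt_of_tendsto (hasDerivAt_exp_kernel a M)
    ((h1.const_mul a).sub (h2.const_mul (M - a))) (tendsto_exp_kernel_atBot ha M)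
    (tendsto_exp_kernel_atTop (by linarith) haM)
  rw [integral_sub (h1.const_mul a) (h2.const_mul (M - a)), integral_const_mul,
    integral_const_mul, sub_zero, sub_eq_zero] at h
  rw [lintegral_expKernel_eq ha (by linarith), lintegral_expKernel_eq (by linarith) (by linarith),
    ← ENNReal.ofReal_mul ha.le, h, ENNReal.ofReal_mul (by linarith)]

theorem lintegral_expKernel_one {N : ℕ} (hN : N ≠ 0) :
    ∫⁻ u, expKernel 1 (N + 1) u = (N : ℝ≥0∞)⁻¹ := by
  have hN' : (0 : ℝ) < N := by positivity
  have h1 := integrable_exp_kernel one_pos (show (1 : ℝ) < N + 1 by linarith)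
  -- The antiderivative is -N⁻¹ (1 + e^u)^(-N); the term 0 * u presents it as the kernel with a = 0,
  -- so that `hasDerivAt_exp_kernel` applies.
  have hd : ∀ u : ℝ, HasDerivAt
      (fun u => -(N : ℝ)⁻¹ * Real.exp (0 * u - N * Real.log (1 + Real.exp u)))
      (Real.exp (1 * u - (N + 1) * Real.log (1 + Real.exp u))) u := by
    intro u
    refine ((hasDerivAt_exp_kernel 0 N u).const_mul (-(N : ℝ)⁻¹)).congr_deriv ?_
    rw [zero_add]
    field_simp
    ring
  have hb : Tendsto (fun u => -(N : ℝ)⁻¹ * Real.exp (0 * u - N * Real.log (1 + Real.exp u)))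
      atBot (𝓝 (-(N : ℝ)⁻¹)) := by
    have h := (tendsto_log_one_add_exp_atBot.const_mul (N : ℝ)).const_sub 0
    have h' := ((Real.continuous_exp.tendsto _).comp h).const_mul (-(N : ℝ)⁻¹)
    simpa [Function.comp_def] using h'
  have ht := (tendsto_exp_kernel_atTop hN'.le hN').const_mul (-(N : ℝ)⁻¹)
  have h := integral_of_hasDerivAt_of_tendsto hd h1 hb ht
  rw [lintegral_expKernel_eq one_pos (by linarith), h]
  simp [ENNReal.ofReal_inv_of_pos hN']

/-- On the negative half-line the kernel is at least 2^(-M). This divergence makes the density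
infinite at the origin when a further λ_j vanishes. -/
theorem lintegral_expKernel_zero {M : ℝ} (hM : 0 ≤ M) : ∫⁻ u, expKernel 0 M u = ∞ := by
  rw [eq_top_iff]
  calc (∞ : ℝ≥0∞) = ∫⁻ _ in Set.Iic (0 : ℝ), ENNReal.ofReal (Real.exp (-(M * Real.log 2))) := by
        rw [setLIntegral_const, Real.volume_Iic, ENNReal.mul_top]
        simp [Real.exp_pos]
    _ ≤ ∫⁻ u in Set.Iic (0 : ℝ), expKernel 0 M u := by
        refine setLIntegral_mono (measurable_expKernel _ _) fun u hu => ?_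
        refine ENNReal.ofReal_le_ofReal (Real.exp_le_exp.2 ?_)
        rw [zero_mul, zero_sub, neg_le_neg_iff]
        refine mul_le_mul_of_nonneg_left (Real.log_le_log (by positivity) ?_) hM
        linarith [Real.exp_le_one_iff.2 (Set.mem_Iic.1 hu)]
    _ ≤ _ := setLIntegral_le_lintegral _ _

theorem lintegral_factorWeight_div_sq (N : ℕ) (ν : ℝ) :
    ∫⁻ x : ℂ, factorWeight N ν x / ‖x‖ₑ ^ 2 =
      ENNReal.ofReal Real.pi * ∫⁻ u, expKernel ν (ν + N + 1) u := by
  have hf := measurable_factorWeight N ν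
  let f : ℝ → ℝ≥0∞ := fun r => factorWeight N ν (r : ℂ) / ‖r‖ₑ ^ 2
  have hfm : Measurable f := by fun_prop
  have h1 : ∀ x : ℂ, factorWeight N ν x / ‖x‖ₑ ^ 2 = f ‖x‖ := by
    intro x
    simp only [enorm_norm, f]
    rw [factorWeight_congr N _ (x := x) (y := (‖x‖ : ℂ)) (by simp)]
  rw [lintegral_congr h1, lintegral_norm_eq hfm]
  congr 1
  refine lintegral_congr fun u => ?_
  have hsq : ‖Real.exp (u / 2)‖ₑ ^ 2 = ENNReal.ofReal (Real.exp u) := by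
    rw [Real.enorm_of_nonneg (by positivity), ← ENNReal.ofReal_pow (by positivity),
      ← Real.exp_nat_mul]
    congr 2; push_cast; ring
  simp only [f]
  rw [hsq, factorWeight_exp, ENNReal.mul_div_cancel (by simp [Real.exp_pos]) ENNReal.ofReal_ne_top]

/-- At z = 0 the argument of the first factor is constantly 0, also where the denominator vanishes,
so the remaining integrals separate. -/
theorem weight_zero {m : ℕ} (N : ℕ) (ν : Fin (m + 1) → ℝ) :
    weight N ν 0 = factorWeight N (ν 0) 0 *
      ∏ j : Fin m, (ENNReal.ofReal Real.pi * ∫⁻ u, expKernel (ν j.succ) (ν j.succ + N + 1) u) := by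
  have hf := fun j => measurable_factorWeight N (ν j)
  simp only [weight, zero_div]
  rw [lintegral_const_mul, lintegral_fin_prod_eq_prod
    (fun (j : Fin m) x => factorWeight N (ν j.succ) x / ‖x‖ₑ ^ 2)
    fun j => (hf _).div (by fun_prop)]
  · simp_rw [lintegral_factorWeight_div_sq]
  · exact Finset.measurable_prod _ fun j _ => ((hf _).comp (by fun_prop)).div (by fun_prop)

/-! ### Uniform bounds for converging concave functions -/

/-- For x ≤ X the point 0 lies between -X and x, so concavity gives f x ≤ (x / X) D ≤ D. For x ≥ X
the function lies below the chord through 0 and X, of slope at most -R. The term R X makes one bound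
cover both cases. -/
theorem concaveOn_le_of_le {f : ℝ → ℝ} (hf : ConcaveOn ℝ Set.univ f) (h0 : f 0 = 0) {X R D : ℝ}
    (hX : 0 < X) (hR : 0 ≤ R) (hD : 0 ≤ D) (h1 : f X ≤ -(R * X)) (h2 : -D ≤ f (-X)) {x : ℝ}
    (hx : 0 ≤ x) : f x ≤ D + R * X - R * x := by
  rcases le_total x X with hxX | hxX
  · have hs : 0 < x + X := by linarith
    have h := hf.2 (Set.mem_univ x) (Set.mem_univ (-X))
      (show 0 ≤ X / (x + X) by positivity) (show 0 ≤ x / (x + X) by positivity)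
      (by field_simp; ring)
    have he : (X / (x + X)) • x + (x / (x + X)) • -X = 0 := by
      simp only [smul_eq_mul]; field_simp; ring
    rw [he, h0] at h
    simp only [smul_eq_mul] at h
    have h3 : X * f x + x * f (-X) ≤ 0 := by
      have := mul_le_mul_of_nonneg_left h hs.le
      rw [mul_zero] at this
      calc X * f x + x * f (-X) = (x + X) * (X / (x + X) * f x + x / (x + X) * f (-X)) := by
            field_simp
        _ ≤ 0 := this
    have h4 : X * f x ≤ X * D := by nlinarith
    have h5 := le_of_mul_le_mul_left h4 hX
    nlinarith
  · have hx' : 0 < x := by linarith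
    have h := hf.2 (Set.mem_univ x) (Set.mem_univ 0)
      (show 0 ≤ X / x by positivity)
      (show 0 ≤ 1 - X / x by rw [sub_nonneg, div_le_one hx']; exact hxX) (by ring)
    have he : (X / x) • x + (1 - X / x) • (0 : ℝ) = X := by
      simp only [smul_eq_mul]; field_simp; ring
    rw [he, h0] at h
    simp only [smul_eq_mul, mul_zero, add_zero] at h
    have h3 : X * f x ≤ x * f X := by
      have := mul_le_mul_of_nonneg_left h hx'.le
      calc X * f x = x * (X / x * f x) := by field_simp
        _ ≤ _ := this
    have h4 : X * f x ≤ X * (-(R * x)) := by nlinarith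
    have h5 := le_of_mul_le_mul_left h4 hX
    nlinarith

theorem concaveOn_comp_neg {f : ℝ → ℝ} (hf : ConcaveOn ℝ Set.univ f) :
    ConcaveOn ℝ Set.univ fun x => f (-x) := by
  refine ⟨convex_univ, fun x _ y _ a b ha hb hab => ?_⟩
  have := hf.2 (Set.mem_univ (-x)) (Set.mem_univ (-y)) ha hb hab
  refine this.trans (le_of_eq ?_)
  congr 1
  simp only [smul_eq_mul]
  ring

/-- Concave functions that converge to a downward parabola decay faster than any given linear
function, uniformly along the sequence. -/
theorem eventually_concave_le {f : ℕ → ℝ → ℝ} {σ : ℝ} (hσ : 0 < σ)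
    (hf : ∀ᶠ n in atTop, ConcaveOn ℝ Set.univ (f n)) (h0 : ∀ n, f n 0 = 0)
    (hlim : ∀ x, Tendsto (fun n => f n x) atTop (𝓝 (-(x ^ 2 / (2 * σ))))) {R : ℝ} (hR : 0 ≤ R) :
    ∃ C, ∀ᶠ n in atTop, ∀ x, f n x ≤ C - R * |x| := by
  -- At this X the limiting parabola equals -(R + 1) X, which leaves room below the required -R X;
  -- the value at -X stays above -(R + 1) X - 1.
  set X := 2 * σ * (R + 1) with hXdef
  have hX : 0 < X := by positivity
  have hlX : X ^ 2 / (2 * σ) = (R + 1) * X := by rw [hXdef]; field_simp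
  have hl1 := hlim X
  have hl2 := hlim (-X)
  rw [neg_sq] at hl2
  rw [hlX] at hl1 hl2
  refine ⟨(R + 1) * X + 1 + R * X, ?_⟩
  have hup : -((R + 1) * X) < -(R * X) := by linarith
  have hlo : -((R + 1) * X + 1) < -((R + 1) * X) := by linarith
  filter_upwards [hf, hl1.eventually (gt_mem_nhds hup), hl2.eventually (gt_mem_nhds hup),
    hl1.eventually (lt_mem_nhds hlo), hl2.eventually (lt_mem_nhds hlo)] with n hc h1 h2 h3 h4 x
  have hD : 0 ≤ (R + 1) * X + 1 := by positivity
  rcases le_total 0 x with hx | hx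
  · rw [abs_of_nonneg hx]
    exact concaveOn_le_of_le hc (h0 n) hX hR hD h1.le h4.le hx
  · rw [abs_of_nonpos hx]
    have := concaveOn_le_of_le (concaveOn_comp_neg hc) (by simp [h0]) hX hR hD h2.le
      (by simpa using h3.le) (neg_nonneg.2 hx)
    simpa using this

/-- On an interval a concave function is bounded below by the smaller of its end values, so
convergence at two points suffices. -/
theorem eventually_le_concave {f : ℕ → ℝ → ℝ} {σ : ℝ}
    (hf : ∀ᶠ n in atTop, ConcaveOn ℝ Set.univ (f n))
    (hlim : ∀ x, Tendsto (fun n => f n x) atTop (𝓝 (-(x ^ 2 / (2 * σ))))) (a b : ℝ) :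
    ∃ C, ∀ᶠ n in atTop, ∀ x ∈ Set.Icc a b, C ≤ f n x := by
  refine ⟨min (-(a ^ 2 / (2 * σ))) (-(b ^ 2 / (2 * σ))) - 1, ?_⟩
  filter_upwards [hf, (hlim a).eventually (lt_mem_nhds (sub_one_lt _)),
    (hlim b).eventually (lt_mem_nhds (sub_one_lt _))] with n hc h1 h2 x hx
  have hseg : x ∈ segment ℝ a b := by
    rw [segment_eq_Icc (hx.1.trans hx.2)]
    exact hx
  have := hc.ge_on_segment (Set.mem_univ a) (Set.mem_univ b) hseg
  refine le_trans (le_min ?_ ?_) this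
  · exact (sub_le_sub_right (min_le_left _ _) 1).trans h1.le
  · exact (sub_le_sub_right (min_le_right _ _) 1).trans h2.le

/-! ### Quadratic expansion of the phase at its saddle point -/

theorem convexOn_log_one_add_exp : ConvexOn ℝ Set.univ fun u : ℝ => Real.log (1 + Real.exp u) := by
  refine Monotone.convexOn_univ_of_deriv
    (fun u => (hasDerivAt_log_one_add_exp u).differentiableAt) fun u v huv => ?_
  rw [(hasDerivAt_log_one_add_exp u).deriv, (hasDerivAt_log_one_add_exp v).deriv,
    div_le_div_iff₀ (by positivity) (by positivity)]
  have := Real.exp_le_exp.2 huv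
  nlinarith

/-- Second-order Taylor expansion: one application of l'Hôpital leaves half a difference quotient of
the logistic function, whose derivative is s(1 - s). -/
theorem tendsto_log_one_add_exp_taylor (η : ℝ) {s : ℝ} (hs : s = Real.exp η / (1 + Real.exp η)) :
    Tendsto (fun δ => (Real.log (1 + Real.exp (η + δ)) - Real.log (1 + Real.exp η) - s * δ) / δ ^ 2)
      (𝓝[≠] 0) (𝓝 (s * (1 - s) / 2)) := by
  have hp : HasDerivAt (fun δ => Real.exp (η + δ) / (1 + Real.exp (η + δ))) (s * (1 - s)) 0 := by
    have he : HasDerivAt (fun δ => Real.exp (η + δ)) (Real.exp η) 0 := by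
      simpa using ((hasDerivAt_id (0 : ℝ)).const_add η).exp
    have h := he.div (he.const_add 1) (by positivity)
    refine h.congr_deriv ?_
    rw [hs, add_zero]
    field_simp
  have hf : ∀ δ : ℝ, HasDerivAt
      (fun δ => Real.log (1 + Real.exp (η + δ)) - Real.log (1 + Real.exp η) - s * δ)
      (Real.exp (η + δ) / (1 + Real.exp (η + δ)) - s) δ := by
    intro δ
    have h1 := (hasDerivAt_log_one_add_exp (η + δ)).comp δ ((hasDerivAt_id δ).const_add η)
    have h2 := (h1.sub_const (Real.log (1 + Real.exp η))).sub ((hasDerivAt_id δ).const_mul s)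
    simpa using! h2
  have hg : ∀ δ : ℝ, HasDerivAt (fun δ : ℝ => δ ^ 2) (2 * δ) δ := by
    intro δ
    simpa using! hasDerivAt_pow 2 δ
  refine HasDerivAt.lhopital_zero_nhdsNE (f' := fun δ => Real.exp (η + δ) / (1 + Real.exp (η + δ)) - s)
    (g' := fun δ => 2 * δ) (Eventually.of_forall hf) (Eventually.of_forall hg) ?_ ?_ ?_ ?_
  · filter_upwards [self_mem_nhdsWithin] with δ hδ
    simpa using hδ
  · have := (hf 0).continuousAt.tendsto
    simp only [add_zero, sub_self, mul_zero] at this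
    exact this.mono_left nhdsWithin_le_nhds
  · have := (hg 0).continuousAt.tendsto
    simp only [ne_eq, OfNat.ofNat_ne_zero, not_false_eq_true, zero_pow] at this
    exact this.mono_left nhdsWithin_le_nhds
  · have h := (hasDerivAt_iff_tendsto_slope.1 hp).div_const 2
    refine h.congr' ?_
    filter_upwards [self_mem_nhdsWithin] with δ hδ
    have hδ' : δ ≠ 0 := hδ
    simp only [slope_def_field, add_zero, sub_zero, ← hs]
    field_simp

/-- The recentred and rescaled logarithm of the kernel `e^(a u) / (1 + e^u)^M`. -/
noncomputable def phase (a M η : ℝ) (n : ℕ) (x : ℝ) : ℝ :=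
  a * (x / √n) - M * (Real.log (1 + Real.exp (η + x / √n)) - Real.log (1 + Real.exp η))

theorem phase_zero (a M η : ℝ) (n : ℕ) : phase a M η n 0 = 0 := by simp [phase]

theorem measurable_phase (a M η : ℝ) (n : ℕ) : Measurable (phase a M η n) := by
  unfold phase
  fun_prop

theorem concaveOn_phase {a M : ℝ} (hM : 0 ≤ M) (η : ℝ) (n : ℕ) :
    ConcaveOn ℝ Set.univ (phase a M η n) := by
  refine ⟨convex_univ, fun x _ y _ p q hp hq hpq => ?_⟩
  have h := convexOn_log_one_add_exp.2 (Set.mem_univ (η + x / √n)) (Set.mem_univ (η + y / √n))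
    hp hq hpq
  have he : p • (η + x / √n) + q • (η + y / √n) = η + (p • x + q • y) / √n := by
    simp only [smul_eq_mul]
    linear_combination η * hpq
  rw [he] at h
  simp only [smul_eq_mul, phase] at h ⊢
  have h' := mul_le_mul_of_nonneg_left h hM
  have e : p * (a * (x / √n) - M * (Real.log (1 + Real.exp (η + x / √n)) - Real.log (1 + Real.exp η)))
      + q * (a * (y / √n) - M * (Real.log (1 + Real.exp (η + y / √n)) - Real.log (1 + Real.exp η)))
      = a * ((p * x + q * y) / √n) - M * (p * Real.log (1 + Real.exp (η + x / √n)) +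
        q * Real.log (1 + Real.exp (η + y / √n))) + M * Real.log (1 + Real.exp η) := by
    linear_combination (M * Real.log (1 + Real.exp η)) * hpq
  rw [e]
  linarith

/-- The point log(α / γ) solves α = (α + γ) s with s the logistic function. Hence the coefficient a
- M s of the linear term stays bounded, and that term dies with x / √n. The quadratic term has
coefficient (α + γ) s (1 - s) / 2 = αγ / (2(α + γ)). -/
theorem tendsto_phase {α γ : ℝ} (hα : 0 < α) (hγ : 0 < γ) {a M : ℕ → ℝ} {D : ℝ}
    (ha : ∀ n : ℕ, |a n - α * n| ≤ D) (hM : ∀ n : ℕ, |M n - (α + γ) * n| ≤ D) (x : ℝ) :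
    Tendsto (fun n => phase (a n) (M n) (Real.log (α / γ)) n x) atTop
      (𝓝 (-(x ^ 2 / (2 * ((α + γ) / (α * γ)))))) := by
  rcases eq_or_ne x 0 with rfl | hx
  · simp [phase_zero]
  set η := Real.log (α / γ)
  set s := Real.exp η / (1 + Real.exp η) with hs
  have hsv : s = α / (α + γ) := by
    rw [hs, Real.exp_log (by positivity)]
    field_simp
    ring
  have hsqrt : Tendsto (fun n : ℕ => √(n : ℝ)) atTop atTop :=
    Real.tendsto_sqrt_atTop.comp tendsto_natCast_atTop_atTop
  have hδ : Tendsto (fun n : ℕ => x / √(n : ℝ)) atTop (𝓝[≠] 0) := by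
    refine tendsto_nhdsWithin_iff.2 ⟨hsqrt.const_div_atTop x, ?_⟩
    filter_upwards [eventually_gt_atTop 0] with n hn
    have : (0 : ℝ) < √n := Real.sqrt_pos.2 (by exact_mod_cast hn)
    exact div_ne_zero hx this.ne'
  have hT := (tendsto_log_one_add_exp_taylor η hs).comp hδ
  have hMn : Tendsto (fun n : ℕ => M n / n) atTop (𝓝 (α + γ)) := by
    rw [tendsto_iff_norm_sub_tendsto_zero]
    refine squeeze_zero' (Eventually.of_forall fun n => norm_nonneg _) ?_
      (tendsto_const_div_atTop_nhds_zero_nat D)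
    filter_upwards [eventually_gt_atTop 0] with n hn
    have hn' : (0 : ℝ) < n := by exact_mod_cast hn
    rw [Real.norm_eq_abs, show M n / n - (α + γ) = (M n - (α + γ) * n) / n by field_simp, abs_div,
      abs_of_pos hn']
    exact div_le_div_of_nonneg_right (hM n) hn'.le
  have hlin : Tendsto (fun n : ℕ => (a n - M n * s) * (x / √n)) atTop (𝓝 0) := by
    have hδ0 : Tendsto (fun n : ℕ => (D + D * s) * |x / √(n : ℝ)|) atTop (𝓝 0) := by
      simpa using ((hsqrt.const_div_atTop x).abs).const_mul (D + D * s)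
    refine squeeze_zero_norm (fun n => ?_) hδ0
    rw [Real.norm_eq_abs, abs_mul]
    refine mul_le_mul_of_nonneg_right ?_ (abs_nonneg _)
    have hs0 : 0 ≤ s := by rw [hsv]; positivity
    have e : a n - M n * s = (a n - α * n) - (M n - (α + γ) * n) * s := by
      rw [hsv]; field_simp; ring
    rw [e]
    refine (abs_sub _ _).trans (add_le_add (ha n) ?_)
    rw [abs_mul, abs_of_nonneg hs0]
    exact mul_le_mul_of_nonneg_right (hM n) hs0
  have hmain := hlin.sub ((hMn.mul hT).mul_const (x ^ 2))
  have hval : 0 - (α + γ) * (s * (1 - s) / 2) * x ^ 2 =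
      -(x ^ 2 / (2 * ((α + γ) / (α * γ)))) := by
    rw [hsv]; field_simp; ring
  rw [hval] at hmain
  refine hmain.congr' ?_
  filter_upwards [eventually_gt_atTop 0] with n hn
  have hn' : (0 : ℝ) < n := by exact_mod_cast hn
  have hsn : √(n : ℝ) ^ 2 = n := Real.sq_sqrt hn'.le
  have hsp : 0 < √(n : ℝ) := Real.sqrt_pos.2 hn'
  simp only [phase, Function.comp_apply, div_pow, hsn]
  field_simp
  ring

/-! ### Gaussian convolutions, limits of convolutions and Riemann sums -/

theorem lintegral_exp_mul_sub_sq (θ : ℝ) {σ : ℝ} (hσ : 0 < σ) :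
    ∫⁻ x : ℝ, ENNReal.ofReal (Real.exp (θ * x - x ^ 2 / (2 * σ))) =
      ENNReal.ofReal (√(2 * Real.pi * σ) * Real.exp (σ * θ ^ 2 / 2)) := by
  have hb : 0 < 1 / (2 * σ) := by positivity
  have h1 : ∀ x : ℝ, ENNReal.ofReal (Real.exp (θ * x - x ^ 2 / (2 * σ))) =
      ENNReal.ofReal (Real.exp (σ * θ ^ 2 / 2)) *
        ENNReal.ofReal (Real.exp (-(1 / (2 * σ)) * (x - σ * θ) ^ 2)) := by
    intro x
    rw [← ENNReal.ofReal_mul (by positivity), ← Real.exp_add]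
    congr 2
    field_simp
    ring
  simp_rw [h1]
  rw [lintegral_const_mul _ (by fun_prop), lintegral_sub_right_eq_self
    (fun x : ℝ => ENNReal.ofReal (Real.exp (-(1 / (2 * σ)) * x ^ 2))),
    ← ofReal_integral_eq_lintegral_ofReal (integrable_exp_neg_mul_sq hb)
      (Eventually.of_forall fun x => by positivity), integral_gaussian,
    ← ENNReal.ofReal_mul (by positivity), mul_comm]
  congr 3
  field_simp

theorem iterConv_gaussian {m : ℕ} {σ : Fin (m + 1) → ℝ} (hσ : ∀ i, 0 < σ i) (y : ℝ) :
    iterConv m (fun i x => ENNReal.ofReal (Real.exp (-(x ^ 2 / (2 * σ i))))) y =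
      ENNReal.ofReal ((∏ i, √(2 * Real.pi * σ i)) / √(2 * Real.pi * ∑ i, σ i) *
        Real.exp (-(y ^ 2 / (2 * ∑ i, σ i)))) := by
  induction m generalizing y with
  | zero =>
    have : √(2 * Real.pi * σ 0) ≠ 0 := by have := hσ 0; positivity
    simp [iterConv, div_self this]
  | succ m ih =>
    simp only [iterConv]
    simp_rw [ih (σ := fun i => σ i.castSucc) fun i => hσ _]
    rw [Fin.prod_univ_castSucc fun i => √(2 * Real.pi * σ i), Fin.sum_univ_castSucc σ]
    set τ := ∑ i : Fin (m + 1), σ i.castSucc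
    set P := ∏ i : Fin (m + 1), √(2 * Real.pi * σ i.castSucc)
    set s := σ (Fin.last (m + 1))
    have hs : 0 < s := hσ _
    have hτ : 0 < τ := Finset.sum_pos (fun i _ => hσ _) Finset.univ_nonempty
    have hP : 0 ≤ P := Finset.prod_nonneg fun i _ => Real.sqrt_nonneg _
    -- In the variable u, the product of Gaussians of variances s and τ is a Gaussian of this
    -- variance, tilted by y / τ.
    have hρ : 0 < s * τ / (s + τ) := by positivity
    have h1 : ∀ u : ℝ, ENNReal.ofReal (Real.exp (-(u ^ 2 / (2 * s)))) *
        ENNReal.ofReal (P / √(2 * Real.pi * τ) * Real.exp (-((y - u) ^ 2 / (2 * τ)))) =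
        ENNReal.ofReal (P / √(2 * Real.pi * τ) * Real.exp (-(y ^ 2 / (2 * τ)))) *
          ENNReal.ofReal (Real.exp (y / τ * u - u ^ 2 / (2 * (s * τ / (s + τ))))) := by
      intro u
      rw [← ENNReal.ofReal_mul (by positivity), ← ENNReal.ofReal_mul (by positivity),
        mul_left_comm, ← Real.exp_add, mul_assoc (P / √(2 * Real.pi * τ)), ← Real.exp_add]
      congr 3
      field_simp
      ring
    rw [lintegral_congr h1]
    rw [lintegral_const_mul _ (by fun_prop), lintegral_exp_mul_sub_sq _ hρ,
      ← ENNReal.ofReal_mul (by positivity)]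
    congr 1
    have h2 : √(2 * Real.pi * (s * τ / (s + τ))) * √(2 * Real.pi * (τ + s)) =
        √(2 * Real.pi * s) * √(2 * Real.pi * τ) := by
      rw [← Real.sqrt_mul (by positivity), ← Real.sqrt_mul (by positivity)]
      congr 1
      field_simp
      ring
    have h3 : Real.exp (-(y ^ 2 / (2 * τ))) * Real.exp (s * τ / (s + τ) * (y / τ) ^ 2 / 2) =
        Real.exp (-(y ^ 2 / (2 * (τ + s)))) := by
      rw [← Real.exp_add]
      congr 1
      field_simp
      ring
    rw [← h3]
    generalize Real.exp (s * τ / (s + τ) * (y / τ) ^ 2 / 2) = E₂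
    generalize Real.exp (-(y ^ 2 / (2 * τ))) = E₁
    have h4 : √(2 * Real.pi * τ) ≠ 0 := by positivity
    have h5 : √(2 * Real.pi * (τ + s)) ≠ 0 := by positivity
    rw [div_mul_eq_mul_div, div_mul_eq_mul_div, div_mul_eq_mul_div, div_eq_div_iff h4 h5]
    linear_combination (P * E₁ * E₂) * h2

/-- Dominated convergence by induction on m. The eventual uniform bound C is part of the conclusion
because the next step dominates its integrand by the integrable bound of the new factor times C. -/
theorem tendsto_iterConv {m : ℕ} {φ : ℕ → Fin (m + 1) → ℝ → ℝ≥0∞} {ψ B : Fin (m + 1) → ℝ → ℝ≥0∞}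
    {K : Fin (m + 1) → ℝ≥0∞} (hφ : ∀ n i, Measurable (φ n i))
    (hB : ∀ i, ∀ᶠ n in atTop, ∀ x, φ n i x ≤ B i x) (hBi : ∀ i, ∫⁻ x, B i x ≠ ∞)
    (hBK : ∀ i x, B i x ≤ K i) (hK : ∀ i, K i ≠ ∞)
    (hlim : ∀ i x, Tendsto (fun n => φ n i x) atTop (𝓝 (ψ i x))) :
    (∀ y, Tendsto (fun n => iterConv m (φ n) y) atTop (𝓝 (iterConv m ψ y))) ∧
      ∃ C, C ≠ ∞ ∧ ∀ᶠ n in atTop, ∀ y, iterConv m (φ n) y ≤ C := by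
  induction m with
  | zero =>
    refine ⟨fun y => hlim 0 y, K 0, hK 0, ?_⟩
    filter_upwards [hB 0] with n hn y
    exact (hn y).trans (hBK 0 y)
  | succ m ih =>
    obtain ⟨h1, C, hC, h2⟩ := ih (φ := fun n i => φ n i.castSucc) (ψ := fun i => ψ i.castSucc)
      (B := fun i => B i.castSucc) (K := fun i => K i.castSucc) (fun n i => hφ n _)
      (fun i => hB _) (fun i => hBi _) (fun i => hBK _) (fun i => hK _) fun i => hlim _
    have hbound : ∀ᶠ n in atTop, ∀ y u, φ n (Fin.last _) u *
        iterConv m (fun i => φ n i.castSucc) (y - u) ≤ B (Fin.last _) u * C := by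
      filter_upwards [h2, hB (Fin.last _)] with n hn1 hn2 y u
      exact mul_le_mul' (hn2 u) (hn1 _)
    have hfin : ∫⁻ u, B (Fin.last _) u * C ≠ ∞ := by
      rw [lintegral_mul_const' _ _ hC]
      exact ENNReal.mul_ne_top (hBi _) hC
    constructor
    · intro y
      refine tendsto_lintegral_filter_of_dominated_convergence
        (fun u => B (Fin.last _) u * C) (Eventually.of_forall fun n => ?_) ?_ hfin
        (Eventually.of_forall fun u => ?_)
      · have h3 := hφ n (Fin.last _)
        have h4 := measurable_iterConv (φ := fun i : Fin (m + 1) => φ n i.castSucc) fun i => hφ n _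
        fun_prop
      · filter_upwards [hbound] with n hn
        exact Eventually.of_forall (hn y)
      · have hψ : ψ (Fin.last _) u ≠ ∞ := by
          refine ne_top_of_le_ne_top (hK (Fin.last _)) (le_of_tendsto (hlim (Fin.last _) u) ?_)
          filter_upwards [hB (Fin.last _)] with n hn
          exact (hn u).trans (hBK _ u)
        have hψ' : iterConv m (fun i => ψ i.castSucc) (y - u) ≠ ∞ := by
          refine ne_top_of_le_ne_top hC (le_of_tendsto (h1 (y - u)) ?_)
          filter_upwards [h2] with n hn
          exact hn _
        exact ENNReal.Tendsto.mul (hlim _ u) (Or.inr hψ') (h1 _) (Or.inr hψ)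
    · refine ⟨∫⁻ u, B (Fin.last _) u * C, hfin, ?_⟩
      filter_upwards [hbound] with n hn y
      exact lintegral_mono (hn y)

theorem lintegral_comp_floor (f : ℤ → ℝ≥0∞) : ∫⁻ x : ℝ, f ⌊x⌋ = ∑' i, f i := by
  rw [← setLIntegral_univ, ← iUnion_Ico_intCast ℝ,
    lintegral_iUnion (fun n => measurableSet_Ico) (Set.pairwise_disjoint_Ico_intCast ℝ)]
  refine tsum_congr fun i => ?_
  rw [setLIntegral_congr_fun (g := fun _ => f i) measurableSet_Ico fun x hx => by
    simp only [Int.floor_eq_iff.2 hx]]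
  simp

/-- The sum is the integral of a step function sampled at ⌊x√n⌋ / √n, extended by zero beyond the
range of l. Since k / n → t lies strictly inside (0, 1), the cutoff disappears at each fixed x. The
sample points move with n, hence the convergence along sequences in `hlim`. -/
theorem tendsto_riemann_sum {g : ℕ → ℝ → ℝ≥0∞} {G : ℝ → ℝ≥0∞} {k : ℕ → ℕ} {t D C : ℝ}
    (ht0 : 0 < t) (ht1 : t < 1) (hk : ∀ n : ℕ, |(k n : ℝ) - t * n| ≤ D)
    (hg : ∀ᶠ n in atTop, ∀ θ, g n θ ≤ ENNReal.ofReal (Real.exp (C - |θ|)))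
    (hlim : ∀ (θ : ℕ → ℝ) (x : ℝ), Tendsto θ atTop (𝓝 x) →
      Tendsto (fun n => g n (θ n)) atTop (𝓝 (G x))) :
    Tendsto (fun n : ℕ => ENNReal.ofReal (1 / √n) *
      ∑ l ∈ Finset.range n, g n (((l : ℝ) - k n) / √n)) atTop (𝓝 (∫⁻ x, G x)) := by
  let f : ℕ → ℤ → ℝ≥0∞ := fun n i => if 0 ≤ (k n : ℤ) + i ∧ (k n : ℤ) + i < n then
    g n ((i : ℝ) / √n) else 0
  have hmeas : ∀ n, Measurable fun x : ℝ => f n ⌊x * √n⌋ := fun n =>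
    (measurable_from_top (f := f n)).comp (Int.measurable_floor.comp (by fun_prop))
  have hsqrt : Tendsto (fun n : ℕ => √(n : ℝ)) atTop atTop :=
    Real.tendsto_sqrt_atTop.comp tendsto_natCast_atTop_atTop
  have hsum : ∀ n, ∑' i, f n i = ∑ l ∈ Finset.range n, g n (((l : ℝ) - k n) / √n) := by
    intro n
    let e : ℕ ↪ ℤ := ⟨fun l => (l : ℤ) - k n, fun a b h => by simpa using h⟩
    have he : ∀ l : ℕ, e l = (l : ℤ) - k n := fun _ => rfl
    rw [tsum_eq_sum (s := (Finset.range n).map e), Finset.sum_map]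
    · refine Finset.sum_congr rfl fun l hl => ?_
      have hl' := Finset.mem_range.1 hl
      simp only [he, f]
      rw [if_pos (by constructor <;> omega)]
      push_cast
      rfl
    · intro i hi
      refine if_neg fun hc => hi (Finset.mem_map.2 ⟨((k n : ℤ) + i).toNat, ?_, ?_⟩)
      · rw [Finset.mem_range]; omega
      · rw [he]; omega
  have hint : ∀ᶠ n : ℕ in atTop, ∫⁻ x : ℝ, f n ⌊x * √n⌋ = ENNReal.ofReal (1 / √n) *
      ∑ l ∈ Finset.range n, g n (((l : ℝ) - k n) / √n) := by
    filter_upwards [eventually_gt_atTop 0] with n hn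
    have hs : 0 < √(n : ℝ) := Real.sqrt_pos.2 (by exact_mod_cast hn)
    rw [← hsum, ← lintegral_comp_floor, lintegral_comp_affine (hmeas n) 0 (one_div_pos.2 hs)]
    congr 1
    refine lintegral_congr fun x => ?_
    congr 2
    field_simp
    ring
  refine Tendsto.congr' hint ?_
  have hfl : ∀ n : ℕ, 0 < n → ∀ x : ℝ, |(⌊x * √n⌋ : ℝ) / √n - x| ≤ 1 / √n := by
    intro n hn x
    have hs : 0 < √(n : ℝ) := Real.sqrt_pos.2 (by exact_mod_cast hn)
    rw [show (⌊x * √n⌋ : ℝ) / √n - x = (⌊x * √n⌋ - x * √n) / √n by field_simp, abs_div,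
      abs_of_pos hs]
    refine div_le_div_of_nonneg_right ?_ hs.le
    rw [abs_le]
    constructor <;> linarith [Int.floor_le (x * √(n : ℝ)), Int.lt_floor_add_one (x * √(n : ℝ))]
  -- The extra 1 in the exponent absorbs the distance between x and its sample point, at most 1 / √n
  -- ≤ 1.
  refine tendsto_lintegral_filter_of_dominated_convergence
    (fun x => ENNReal.ofReal (Real.exp (C + 1 - 1 * |x|))) (Eventually.of_forall hmeas) ?_
    (lintegral_exp_sub_mul_abs_ne_top _ one_pos) (Eventually.of_forall fun x => ?_)
  · filter_upwards [hg, eventually_gt_atTop 0] with n hn hn0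
    refine Eventually.of_forall fun x => ?_
    simp only [f]
    split_ifs
    · refine (hn _).trans (ENNReal.ofReal_le_ofReal (Real.exp_le_exp.2 ?_))
      have h1 : (1 : ℝ) ≤ √n := Real.one_le_sqrt.2 (by exact_mod_cast hn0)
      have h2 : 1 / √(n : ℝ) ≤ 1 := (div_le_one (by linarith)).2 h1
      have h3 := hfl n hn0 x
      have h4 := abs_sub_abs_le_abs_sub x ((⌊x * √n⌋ : ℝ) / √n)
      rw [abs_sub_comm] at h4
      linarith
    · exact zero_le
  · have hθ : Tendsto (fun n : ℕ => (⌊x * √(n : ℝ)⌋ : ℝ) / √n) atTop (𝓝 x) := by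
      rw [tendsto_iff_norm_sub_tendsto_zero]
      refine squeeze_zero' (Eventually.of_forall fun n => norm_nonneg _) ?_
        (hsqrt.const_div_atTop 1)
      filter_upwards [eventually_gt_atTop 0] with n hn
      exact hfl n hn x
    refine (hlim _ x hθ).congr' ?_
    have hinv : Tendsto (fun n : ℕ => (D : ℝ) / n) atTop (𝓝 0) :=
      tendsto_const_div_atTop_nhds_zero_nat D
    have hr : Tendsto (fun n : ℕ => ((⌊x * √(n : ℝ)⌋ : ℝ) / √n) * (1 / √(n : ℝ))) atTop (𝓝 0) := by
      simpa using hθ.mul (hsqrt.const_div_atTop 1)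
    have hkn : Tendsto (fun n : ℕ => (k n : ℝ) / n) atTop (𝓝 t) := by
      rw [tendsto_iff_norm_sub_tendsto_zero]
      refine squeeze_zero' (Eventually.of_forall fun n => norm_nonneg _) ?_ hinv
      filter_upwards [eventually_gt_atTop 0] with n hn
      have hn' : (0 : ℝ) < n := by exact_mod_cast hn
      rw [Real.norm_eq_abs, show (k n : ℝ) / n - t = (k n - t * n) / n by field_simp, abs_div,
        abs_of_pos hn']
      exact div_le_div_of_nonneg_right (hk n) hn'.le
    have htot := hkn.add hr
    rw [add_zero] at htot
    filter_upwards [htot.eventually (lt_mem_nhds ht0), htot.eventually (gt_mem_nhds ht1),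
      eventually_gt_atTop 0] with n h1 h2 hn
    have hn' : (0 : ℝ) < n := by exact_mod_cast hn
    have hsn : √(n : ℝ) * √n = n := Real.mul_self_sqrt hn'.le
    have e : (k n : ℝ) / n + ((⌊x * √(n : ℝ)⌋ : ℝ) / √n) * (1 / √(n : ℝ)) =
        (((k n : ℤ) + ⌊x * √(n : ℝ)⌋ : ℤ) : ℝ) / n := by
      rw [div_mul_div_comm, hsn]; push_cast; ring
    rw [e] at h1 h2
    have h1' : (0 : ℝ) < (((k n : ℤ) + ⌊x * √(n : ℝ)⌋ : ℤ) : ℝ) := by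
      have := mul_pos h1 hn'
      rwa [div_mul_cancel₀ _ hn'.ne'] at this
    have h2' : (((k n : ℤ) + ⌊x * √(n : ℝ)⌋ : ℤ) : ℝ) < n := (div_lt_one hn').1 h2
    refine (if_pos ⟨?_, ?_⟩).symm
    · exact_mod_cast h1'.le
    · exact_mod_cast h2'

/-! ### Laplace's method -/

section Laplace

variable {f : ℕ → ℝ → ℝ} {σ : ℝ}

theorem tendsto_lintegral_exp_tilt (hσ : 0 < σ) (hm : ∀ n, Measurable (f n))
    (hf : ∀ᶠ n in atTop, ConcaveOn ℝ Set.univ (f n)) (h0 : ∀ n, f n 0 = 0)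
    (hlim : ∀ x, Tendsto (fun n => f n x) atTop (𝓝 (-(x ^ 2 / (2 * σ))))) {θ : ℕ → ℝ} {ϑ : ℝ}
    (hθ : Tendsto θ atTop (𝓝 ϑ)) :
    Tendsto (fun n => ∫⁻ x, ENNReal.ofReal (Real.exp (θ n * x + f n x))) atTop
      (𝓝 (ENNReal.ofReal (√(2 * Real.pi * σ) * Real.exp (σ * ϑ ^ 2 / 2)))) := by
  rw [← lintegral_exp_mul_sub_sq ϑ hσ]
  -- Eventually |θ n| ≤ |ϑ| + 1, so slope |ϑ| + 2 leaves an integrable e^(-|x|).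
  obtain ⟨C, hC⟩ := eventually_concave_le hσ hf h0 hlim (R := |ϑ| + 2) (by positivity)
  refine tendsto_lintegral_filter_of_dominated_convergence
    (fun x => ENNReal.ofReal (Real.exp (C - 1 * |x|))) (Eventually.of_forall fun n => ?_) ?_
    (lintegral_exp_sub_mul_abs_ne_top _ one_pos) (Eventually.of_forall fun x => ?_)
  · have := hm n
    fun_prop
  · filter_upwards [hC, hθ.abs.eventually (gt_mem_nhds (lt_add_one _))] with n h1 h2
    refine Eventually.of_forall fun x => ENNReal.ofReal_le_ofReal (Real.exp_le_exp.2 ?_)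
    have h3 : θ n * x ≤ |θ n| * |x| := by rw [← abs_mul]; exact le_abs_self _
    nlinarith [h1 x, abs_nonneg x]
  · refine (ENNReal.continuous_ofReal.tendsto _).comp ((Real.continuous_exp.tendsto _).comp ?_)
    rw [sub_eq_add_neg]
    exact (hθ.mul_const x).add (hlim x)

/-- It suffices to integrate over [1, 2] or [-2, -1], according to the sign of θ: there θ x ≥ |θ|
and f is bounded below. Uniformity in θ is what dominates the reciprocals in the sum over degrees.
-/
theorem eventually_le_lintegral_exp_tilt
    (hf : ∀ᶠ n in atTop, ConcaveOn ℝ Set.univ (f n))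
    (hlim : ∀ x, Tendsto (fun n => f n x) atTop (𝓝 (-(x ^ 2 / (2 * σ))))) :
    ∃ C : ℝ, ∀ᶠ n in atTop, ∀ θ : ℝ, ENNReal.ofReal (Real.exp (|θ| - C)) ≤
      ∫⁻ x, ENNReal.ofReal (Real.exp (θ * x + f n x)) := by
  obtain ⟨C₁, h₁⟩ := eventually_le_concave hf hlim 1 2
  obtain ⟨C₂, h₂⟩ := eventually_le_concave hf hlim (-2) (-1)
  have key : ∀ (a : ℝ) (c : ℝ) (h : ℝ → ℝ), (∀ x ∈ Set.Icc a (a + 1), c ≤ h x) →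
      ENNReal.ofReal (Real.exp c) ≤ ∫⁻ x, ENNReal.ofReal (Real.exp (h x)) := by
    intro a c h hc
    calc ENNReal.ofReal (Real.exp c)
        = ∫⁻ _ in Set.Icc a (a + 1), ENNReal.ofReal (Real.exp c) := by simp
      _ ≤ ∫⁻ x in Set.Icc a (a + 1), ENNReal.ofReal (Real.exp (h x)) :=
          setLIntegral_mono' measurableSet_Icc fun x hx =>
            ENNReal.ofReal_le_ofReal (Real.exp_le_exp.2 (hc x hx))
      _ ≤ _ := setLIntegral_le_lintegral _ _
  refine ⟨max (-C₁) (-C₂), ?_⟩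
  filter_upwards [h₁, h₂] with n hn1 hn2 θ
  have hm1 := le_max_left (-C₁) (-C₂)
  have hm2 := le_max_right (-C₁) (-C₂)
  rcases le_total 0 θ with hθ | hθ
  · refine key 1 _ _ fun x hx => ?_
    have := hn1 x ⟨hx.1, by linarith [hx.2]⟩
    rw [abs_of_nonneg hθ]
    nlinarith [hx.1]
  · refine key (-2) _ _ fun x hx => ?_
    have := hn2 x ⟨hx.1, by linarith [hx.2]⟩
    rw [abs_of_nonpos hθ]
    nlinarith [hx.2]

end Laplace

/-- Put P = ∏ √(2πσ_j) and S = ∑ σ_j. The convolution at 0 tends to P / √(2πS). The sum is a Riemann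
sum with limit P⁻¹ ∫ e^(-Sθ²/2) dθ = P⁻¹ √(2π/S). The product of the two is 1/S. -/
theorem tendsto_iterConv_mul_sum {m : ℕ} {f : Fin (m + 1) → ℕ → ℝ → ℝ} {σ : Fin (m + 1) → ℝ}
    (hσ : ∀ j, 0 < σ j) (hm : ∀ j n, Measurable (f j n))
    (hf : ∀ j, ∀ᶠ n in atTop, ConcaveOn ℝ Set.univ (f j n)) (h0 : ∀ j n, f j n 0 = 0)
    (hlim : ∀ j x, Tendsto (fun n => f j n x) atTop (𝓝 (-(x ^ 2 / (2 * σ j)))))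
    {k : ℕ → ℕ} {t D : ℝ} (ht0 : 0 < t) (ht1 : t < 1) (hk : ∀ n : ℕ, |(k n : ℝ) - t * n| ≤ D) :
    Tendsto (fun n : ℕ => iterConv m (fun j x => ENNReal.ofReal (Real.exp (f j n x))) 0 *
      (ENNReal.ofReal (1 / √n) * ∑ l ∈ Finset.range n,
        (∏ j, ∫⁻ x, ENNReal.ofReal (Real.exp (((l : ℝ) - k n) / √n * x + f j n x)))⁻¹))
      atTop (𝓝 (ENNReal.ofReal (1 / ∑ j, σ j))) := by
  have hconv : Tendsto (fun n : ℕ => iterConv m (fun j x => ENNReal.ofReal (Real.exp (f j n x))) 0)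
      atTop (𝓝 (ENNReal.ofReal
        ((∏ i, √(2 * Real.pi * σ i)) / √(2 * Real.pi * ∑ i, σ i)))) := by
    have h := iterConv_gaussian hσ 0
    simp only [ne_eq, OfNat.ofNat_ne_zero, not_false_eq_true, zero_pow, zero_div, neg_zero,
      Real.exp_zero, mul_one] at h
    rw [← h]
    choose C hC using fun j => eventually_concave_le (hσ j) (hf j) (h0 j) (hlim j) zero_le_one
    refine (tendsto_iterConv (B := fun j x => ENNReal.ofReal (Real.exp (C j - 1 * |x|)))
      (K := fun j => ENNReal.ofReal (Real.exp (C j))) (fun n j => ?_) (fun j => ?_)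
      (fun j => lintegral_exp_sub_mul_abs_ne_top _ one_pos) (fun j x => ?_)
      (fun j => ENNReal.ofReal_ne_top) fun j x => ?_).1 0
    · have := hm j n
      fun_prop
    · filter_upwards [hC j] with n hn x
      exact ENNReal.ofReal_le_ofReal (Real.exp_le_exp.2 (hn x))
    · refine ENNReal.ofReal_le_ofReal (Real.exp_le_exp.2 ?_)
      linarith [abs_nonneg x]
    · exact (ENNReal.continuous_ofReal.tendsto _).comp
        ((Real.continuous_exp.tendsto _).comp (hlim j x))
  set S := ∑ i, σ i with hS
  have hSpos : 0 < S := Finset.sum_pos (fun i _ => hσ i) Finset.univ_nonempty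
  set P := ∏ i, √(2 * Real.pi * σ i) with hP
  have hPpos : 0 < P := Finset.prod_pos fun i _ => by have := hσ i; positivity
  choose C hC using fun j => eventually_le_lintegral_exp_tilt (hf j) (hlim j)
  -- The limit is written with a zero tilt and variance S⁻¹ to match `lintegral_exp_mul_sub_sq`.
  have hsum := tendsto_riemann_sum (G := fun θ => ENNReal.ofReal (P⁻¹ * Real.exp (0 * θ -
      θ ^ 2 / (2 * S⁻¹)))) (C := ∑ j, C j)
    (g := fun n θ => (∏ j, ∫⁻ x, ENNReal.ofReal (Real.exp (θ * x + f j n x)))⁻¹) ht0 ht1 hk ?_ ?_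
  · have hG : ∫⁻ θ : ℝ, ENNReal.ofReal (P⁻¹ * Real.exp (0 * θ - θ ^ 2 / (2 * S⁻¹))) =
        ENNReal.ofReal (P⁻¹ * √(2 * Real.pi * S⁻¹)) := by
      simp_rw [ENNReal.ofReal_mul (inv_nonneg.2 hPpos.le)]
      rw [lintegral_const_mul _ (by fun_prop), lintegral_exp_mul_sub_sq _ (inv_pos.2 hSpos)]
      simp
    rw [hG] at hsum
    have h := ENNReal.Tendsto.mul hconv (Or.inr ENNReal.ofReal_ne_top) hsum
      (Or.inr ENNReal.ofReal_ne_top)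
    rw [← ENNReal.ofReal_mul (by positivity)] at h
    have hval : P / √(2 * Real.pi * S) * (P⁻¹ * √(2 * Real.pi * S⁻¹)) = 1 / S := by
      have h1 : √(2 * Real.pi * S⁻¹) = √(2 * Real.pi * S) / S := by
        rw [eq_div_iff hSpos.ne']
        nth_rewrite 2 [← Real.sqrt_sq hSpos.le]
        rw [← Real.sqrt_mul (by positivity)]
        congr 1
        field_simp
      have h2 : √(2 * Real.pi * S) ≠ 0 := by positivity
      rw [h1]
      field_simp
    rwa [hval] at h
  · filter_upwards [eventually_all.2 hC] with n hn θ
    have h1 : ∏ j, ENNReal.ofReal (Real.exp (|θ| - C j)) ≤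
        ∏ j, ∫⁻ x, ENNReal.ofReal (Real.exp (θ * x + f j n x)) :=
      Finset.prod_le_prod' fun j _ => hn j θ
    refine (ENNReal.inv_le_inv.2 h1).trans ?_
    rw [← ENNReal.ofReal_prod_of_nonneg fun j _ => (Real.exp_pos _).le, ← Real.exp_sum,
      ← ENNReal.ofReal_inv_of_pos (Real.exp_pos _), ← Real.exp_neg]
    refine ENNReal.ofReal_le_ofReal (Real.exp_le_exp.2 ?_)
    rw [Finset.sum_sub_distrib, Finset.sum_const, Finset.card_univ, Fintype.card_fin, nsmul_eq_mul]
    push_cast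
    -- The m + 1 factors together give decay e^(-(m + 1)|θ|), of which e^(-|θ|) is enough.
    have : 0 ≤ (m : ℝ) * |θ| := by positivity
    linarith
  · intro θ x hθ
    have h1 : Tendsto (fun n => ∏ j, ∫⁻ y, ENNReal.ofReal (Real.exp (θ n * y + f j n y))) atTop
        (𝓝 (∏ j, ENNReal.ofReal (√(2 * Real.pi * σ j) * Real.exp (σ j * x ^ 2 / 2)))) :=
      ENNReal.tendsto_finsetProd_of_ne_top _
        (fun j _ => tendsto_lintegral_exp_tilt (hσ j) (hm j) (hf j) (h0 j) (hlim j) hθ)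
        fun j _ => ENNReal.ofReal_ne_top
    have h2 := tendsto_inv_iff.2 h1
    convert h2 using 2
    rw [← ENNReal.ofReal_prod_of_nonneg fun j _ => by positivity,
      ← ENNReal.ofReal_inv_of_pos (Finset.prod_pos fun j _ => by have := hσ j; positivity),
      Finset.prod_mul_distrib, ← hP, mul_inv, ← Real.exp_sum, ← Real.exp_neg, ← Finset.sum_div,
      ← Finset.sum_mul, ← hS]
    congr 3
    field_simp
    ring

/-! ### Asymptotics of the one-point density -/

/-- The limit `μ(t) = log ∏ᵢ (t + λᵢ) / (1 - t)` of the logarithm of the squared modulus. -/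
noncomputable def logModulus {m : ℕ} (lam : Fin (m + 1) → ℝ) (t : ℝ) : ℝ :=
  ∑ i, Real.log ((t + lam i) / (1 - t))

/-- The derivative of `logModulus`. -/
noncomputable def logModulusDeriv {m : ℕ} (lam : Fin (m + 1) → ℝ) (t : ℝ) : ℝ :=
  ∑ i, (1 + lam i) / ((t + lam i) * (1 - t))

theorem moment_ne_zero {m : ℕ} (N : ℕ) (ν : Fin (m + 1) → ℝ) (k : ℕ) :
    ∫⁻ x : ℂ, ‖x‖ₑ ^ (2 * k) * weight N ν x ≠ 0 := by
  rw [lintegral_pow_mul_weight]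
  refine mul_ne_zero (pow_ne_zero _ (by simp [Real.pi_pos])) ?_
  exact Finset.prod_ne_zero_iff.2 fun j _ => lintegral_expKernel_ne_zero _ _

theorem moment_ne_top {m : ℕ} {N : ℕ} {ν : Fin (m + 1) → ℝ} (hν : ∀ i, 0 ≤ ν i) {k : ℕ}
    (hk : k < N) : ∫⁻ x : ℂ, ‖x‖ₑ ^ (2 * k) * weight N ν x ≠ ∞ := by
  rw [lintegral_pow_mul_weight]
  refine ENNReal.mul_ne_top (ENNReal.pow_ne_top ENNReal.ofReal_ne_top) ?_
  refine ENNReal.prod_ne_top fun j _ => lintegral_expKernel_ne_top ?_ ?_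
  · have := hν j
    positivity
  · have : (k : ℝ) < N := by exact_mod_cast hk
    linarith

theorem eigenvalueDensity_eq_sum {m : ℕ} {N : ℕ} (hN : 0 < N) {ν : Fin (m + 1) → ℝ}
    (hν : ∀ i, 0 ≤ ν i) (z : ℂ) :
    eigenvalueDensity N ν z = (N : ℝ≥0∞)⁻¹ * (weight N ν z * ∑ k ∈ Finset.range N,
      ‖z‖ₑ ^ (2 * k) / (ENNReal.ofReal Real.pi ^ (m + 1) *
        ∏ j, ∫⁻ u, expKernel (ν j + 1 + k) (ν j + N + 1) u)) := by
  obtain ⟨n, rfl⟩ := Nat.exists_eq_succ_of_ne_zero hN.ne'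
  simp_rw [← lintegral_pow_mul_weight]
  exact eigenvalueDensity_eq n ν (H := fun k => ∫⁻ x, ‖x‖ₑ ^ (2 * k) * weight (n + 1) ν x)
    (fun k => rfl) (fun k _ => moment_ne_zero _ _ _) (fun k hk => moment_ne_top hν hk) z

theorem measurable_eigenvalueDensity {m : ℕ} {N : ℕ} (hN : 0 < N) {ν : Fin (m + 1) → ℝ}
    (hν : ∀ i, 0 ≤ ν i) : Measurable (eigenvalueDensity N ν) := by
  have h := measurable_weight N ν
  simp_rw [funext (eigenvalueDensity_eq_sum hN hν)]
  fun_prop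

/-- The tilt l is split as k + (l - k): the part k enters the phase and places its saddle at η, and
(l - k) / √N is the variable of the Riemann sum. -/
theorem expKernel_rescale (a M η : ℝ) (N : ℕ) (k l x : ℝ) :
    expKernel (a + l) M (η + 1 / √N * x) = expKernel a M η * ENNReal.ofReal (Real.exp (l * η)) *
      ENNReal.ofReal (Real.exp ((l - k) / √N * x + phase (a + k) M η N x)) := by
  simp only [expKernel]
  rw [← ENNReal.ofReal_mul (by positivity), ← ENNReal.ofReal_mul (by positivity), ← Real.exp_add,
    ← Real.exp_add]
  congr 2
  rw [phase, show 1 / √(N : ℝ) * x = x / √N by ring]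
  ring

/-- An exact identity for every N. The kernel values at the η_j occur once in the weight and once in
each moment, and |z|^(2l) = e^(l ∑ η_j) cancels the tilts. The weight carries m Jacobians 1/√N and
each moment m + 1, so the prefactor 1/N leaves a single 1/√N, the mesh of the sum. -/
theorem eigenvalueDensity_rescale {m : ℕ} {N : ℕ} (hN : 0 < N) {ν : Fin (m + 1) → ℝ}
    (hν : ∀ i, 0 ≤ ν i) (η : Fin (m + 1) → ℝ) (k : ℝ) :
    ENNReal.ofReal Real.pi * (ENNReal.ofReal (Real.exp (∑ j, η j)) *
      eigenvalueDensity N ν (Real.exp ((∑ j, η j) / 2) : ℂ)) =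
      iterConv m (fun j x => ENNReal.ofReal
        (Real.exp (phase (ν j + 1 + k) (ν j + N + 1) (η j) N x))) 0 *
      (ENNReal.ofReal (1 / √N) * ∑ l ∈ Finset.range N, (∏ j, ∫⁻ x, ENNReal.ofReal
        (Real.exp (((l : ℝ) - k) / √N * x +
          phase (ν j + 1 + k) (ν j + N + 1) (η j) N x)))⁻¹) := by
  have hN' : (0 : ℝ) < N := by exact_mod_cast hN
  have hs : 0 < √(N : ℝ) := Real.sqrt_pos.2 hN'
  have hε : 0 < 1 / √(N : ℝ) := one_div_pos.2 hs
  have hph := fun j => measurable_phase (ν j + 1 + k) (ν j + N + 1) (η j) N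
  set p := ENNReal.ofReal Real.pi with hp
  set e := ENNReal.ofReal (1 / √(N : ℝ)) with he
  set y := ∑ j, η j with hy
  set c : Fin (m + 1) → ℝ≥0∞ := fun j => expKernel (ν j + 1) (ν j + N + 1) (η j) with hc
  set X := iterConv m (fun j x => ENNReal.ofReal
        (Real.exp (phase (ν j + 1 + k) (ν j + N + 1) (η j) N x))) 0 with hX
  set I : ℕ → Fin (m + 1) → ℝ≥0∞ := fun l j => ∫⁻ x, ENNReal.ofReal
        (Real.exp (((l : ℝ) - k) / √N * x +
          phase (ν j + 1 + k) (ν j + N + 1) (η j) N x)) with hI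
  have hp0 : p ≠ 0 := by simp [hp, Real.pi_pos]
  have hpt : p ≠ ∞ := ENNReal.ofReal_ne_top
  have he0 : e ≠ 0 := by rw [he, Ne, ENNReal.ofReal_eq_zero, not_le]; exact hε
  have het : e ≠ ∞ := ENNReal.ofReal_ne_top
  have hC0 : ∏ j, c j ≠ 0 := Finset.prod_ne_zero_iff.2 fun j _ => by simp [hc, expKernel, Real.exp_pos]
  have hCt : ∏ j, c j ≠ ∞ := ENNReal.prod_ne_top fun j _ => ENNReal.ofReal_ne_top
  have hW : weight N ν (Real.exp (y / 2) : ℂ) * ENNReal.ofReal (Real.exp y) =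
      p ^ m * (e ^ m * (∏ j, c j) * X) := by
    rw [weight_mul_exp]
    congr 1
    have := iterConv_rescale (φ := fun j => expKernel (ν j + 1) (ν j + N + 1))
      (ψ := fun j x => ENNReal.ofReal
        (Real.exp (phase (ν j + 1 + k) (ν j + N + 1) (η j) N x))) (η := η) (c := c)
      (κ := -k / √N) (fun i => measurable_expKernel _ _) (fun i => by have := hph i; fun_prop) hε
      (fun i x => by
        have := expKernel_rescale (ν i + 1) (ν i + N + 1) (η i) N k 0 x
        simp only [add_zero, zero_mul, Real.exp_zero, ENNReal.ofReal_one, mul_one, zero_sub] at this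
        rw [this, Real.exp_add, ENNReal.ofReal_mul (by positivity)]) 0
    simpa only [mul_zero, add_zero, Real.exp_zero, ENNReal.ofReal_one, one_mul] using this
  have hJ : ∀ l : ℕ, p ^ (m + 1) * ∏ j, ∫⁻ u, expKernel (ν j + 1 + l) (ν j + N + 1) u =
      (p ^ (m + 1) * e ^ (m + 1) * (∏ j, c j) * ENNReal.ofReal (Real.exp (l * y))) *
        ∏ j, I l j := by
    intro l
    have h1 : ∀ j, ∫⁻ u, expKernel (ν j + 1 + l) (ν j + N + 1) u =
        e * (c j * ENNReal.ofReal (Real.exp (l * η j))) * I l j := by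
      intro j
      have := hph j
      rw [lintegral_comp_affine (measurable_expKernel _ _) (η j) hε, mul_assoc]
      congr 1
      simp_rw [expKernel_rescale (ν j + 1) (ν j + N + 1) (η j) N k l]
      rw [lintegral_const_mul _ (by fun_prop)]
    simp_rw [h1, Finset.prod_mul_distrib]
    rw [Finset.prod_const, Finset.card_univ, Fintype.card_fin,
      ← ENNReal.ofReal_prod_of_nonneg fun j _ => (Real.exp_pos _).le, ← Real.exp_sum,
      ← Finset.mul_sum]
    ring
  have hz : ∀ l : ℕ, ‖(Real.exp (y / 2) : ℂ)‖ₑ ^ (2 * l) = ENNReal.ofReal (Real.exp (l * y)) := by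
    intro l
    rw [← ofReal_norm, Complex.norm_real, Real.norm_of_nonneg (by positivity),
      ← ENNReal.ofReal_pow (by positivity), ← Real.exp_nat_mul]
    congr 2
    push_cast; ring
  have hNe : (N : ℝ≥0∞)⁻¹ = e * e := by
    rw [he, ← ENNReal.ofReal_mul hε.le, div_mul_div_comm, Real.mul_self_sqrt hN'.le, one_mul,
      one_div, ENNReal.ofReal_inv_of_pos hN', ENNReal.ofReal_natCast]
  rw [eigenvalueDensity_eq_sum hN hν]
  calc p * (ENNReal.ofReal (Real.exp y) * ((N : ℝ≥0∞)⁻¹ * (weight N ν (Real.exp (y / 2) : ℂ) *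
        ∑ l ∈ Finset.range N, ‖(Real.exp (y / 2) : ℂ)‖ₑ ^ (2 * l) / (p ^ (m + 1) *
        ∏ j, ∫⁻ u, expKernel (ν j + 1 + l) (ν j + N + 1) u))))
      = (weight N ν (Real.exp (y / 2) : ℂ) * ENNReal.ofReal (Real.exp y)) * p * (N : ℝ≥0∞)⁻¹ *
        ∑ l ∈ Finset.range N, ‖(Real.exp (y / 2) : ℂ)‖ₑ ^ (2 * l) / (p ^ (m + 1) *
        ∏ j, ∫⁻ u, expKernel (ν j + 1 + l) (ν j + N + 1) u) := by ring
    _ = X * (e * ∑ l ∈ Finset.range N, (∏ j, I l j)⁻¹) := by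
      rw [hW, hNe, Finset.mul_sum, Finset.mul_sum, Finset.mul_sum]
      refine Finset.sum_congr rfl fun l _ => ?_
      have hY0 : ENNReal.ofReal (Real.exp (l * y)) ≠ 0 := by simp [Real.exp_pos]
      rw [hz, hJ]
      set Y := ENNReal.ofReal (Real.exp (l * y))
      have hYt : Y ≠ ∞ := ENNReal.ofReal_ne_top
      set A := p ^ (m + 1) * e ^ (m + 1) * (∏ j, c j) * Y with hA
      have hA0 : A ≠ 0 :=
        mul_ne_zero (mul_ne_zero (mul_ne_zero (pow_ne_zero _ hp0) (pow_ne_zero _ he0)) hC0) hY0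
      have hAt : A ≠ ∞ := ENNReal.mul_ne_top (ENNReal.mul_ne_top (ENNReal.mul_ne_top
        (ENNReal.pow_ne_top hpt) (ENNReal.pow_ne_top het)) hCt) hYt
      rw [div_eq_mul_inv, ENNReal.mul_inv (Or.inl hA0) (Or.inl hAt)]
      calc p ^ m * (e ^ m * (∏ j, c j) * X) * p * (e * e) * (Y * (A⁻¹ * (∏ j, I l j)⁻¹))
          = (p ^ (m + 1) * e ^ (m + 1) * (∏ j, c j) * Y * A⁻¹) * (X * (e * (∏ j, I l j)⁻¹)) := by
            ring
        _ = X * (e * (∏ j, I l j)⁻¹) := by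
            rw [← hA, ENNReal.mul_inv_cancel hA0 hAt, one_mul]

theorem logModulusDeriv_pos {m : ℕ} {lam : Fin (m + 1) → ℝ} (hlam : ∀ i, 0 ≤ lam i) {t : ℝ}
    (ht0 : 0 < t) (ht1 : t < 1) : 0 < logModulusDeriv lam t := by
  have h1 : 0 < 1 - t := by linarith
  refine Finset.sum_pos (fun i _ => ?_) Finset.univ_nonempty
  have := hlam i
  positivity

theorem tendsto_eigenvalueDensity_exp {m : ℕ} {lam : Fin (m + 1) → ℝ} (hlam : ∀ i, 0 ≤ lam i)
    {t : ℝ} (ht0 : 0 < t) (ht1 : t < 1) :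
    Tendsto (fun N : ℕ => eigenvalueDensity N (fun i => lam i * (N : ℝ))
      (Real.exp (logModulus lam t / 2) : ℂ)) atTop
      (𝓝 (ENNReal.ofReal (1 / (Real.pi * Real.exp (logModulus lam t) * logModulusDeriv lam t)))) := by
  have h1 : 0 < 1 - t := by linarith
  have hk : ∀ n : ℕ, |(⌊t * n⌋₊ : ℝ) - t * n| ≤ 1 := by
    intro n
    have := Nat.floor_le (show 0 ≤ t * n by positivity)
    have := Nat.lt_floor_add_one (t * (n : ℝ))
    rw [abs_le]
    constructor <;> linarith
  have hσ : ∀ j, 0 < (t + lam j + (1 - t)) / ((t + lam j) * (1 - t)) := by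
    intro j
    have := hlam j
    positivity
  -- Here α = t + λ_j, γ = 1 - t and k = ⌊tN⌋. The exponents differ from αN and (α + γ)N by the
  -- additive 1 and the rounding of tN, so by at most 2.
  have key := tendsto_iterConv_mul_sum
    (f := fun j n => phase (lam j * n + 1 + ⌊t * n⌋₊) (lam j * n + n + 1)
      (Real.log ((t + lam j) / (1 - t))) n)
    (σ := fun j => (t + lam j + (1 - t)) / ((t + lam j) * (1 - t))) hσ
    (fun j n => measurable_phase _ _ _ _)
    (fun j => Eventually.of_forall fun n => concaveOn_phase
      (by have := hlam j; positivity) _ _)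
    (fun j n => phase_zero _ _ _ _)
    (fun j x => tendsto_phase (D := 2) (by have := hlam j; positivity) h1
      (fun n => by
        have := hk n
        rw [abs_le] at this ⊢
        constructor <;> nlinarith)
      (fun n => by
        rw [show lam j * (n : ℝ) + n + 1 - (t + lam j + (1 - t)) * n = 1 by ring]
        norm_num) x)
    ht0 ht1 hk
  set y := logModulus lam t with hy
  have hsum : ∑ j, (t + lam j + (1 - t)) / ((t + lam j) * (1 - t)) = logModulusDeriv lam t := by
    refine Finset.sum_congr rfl fun j _ => ?_
    congr 1; ring
  rw [hsum] at key
  set A := ENNReal.ofReal (Real.pi * Real.exp y) with hA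
  have hA0 : A ≠ 0 := by
    rw [hA, Ne, ENNReal.ofReal_eq_zero, not_le]
    positivity
  have hAt : A ≠ ∞ := ENNReal.ofReal_ne_top
  have h2 := ENNReal.Tendsto.const_mul (a := A⁻¹) key (Or.inr (ENNReal.inv_ne_top.2 hA0))
  have hd := logModulusDeriv_pos hlam ht0 ht1
  rw [hA, ← ENNReal.ofReal_inv_of_pos (by positivity), ← ENNReal.ofReal_mul (by positivity),
    show (Real.pi * Real.exp y)⁻¹ * (1 / logModulusDeriv lam t) =
      1 / (Real.pi * Real.exp y * logModulusDeriv lam t) by field_simp] at h2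
  refine h2.congr' ?_
  filter_upwards [eventually_gt_atTop 0] with N hN
  have h3 := eigenvalueDensity_rescale hN (ν := fun i => lam i * (N : ℝ))
    (fun i => by have := hlam i; positivity) (fun j => Real.log ((t + lam j) / (1 - t)))
    (⌊t * N⌋₊ : ℝ)
  rw [← h3]
  change _ * (_ * (ENNReal.ofReal (Real.exp y) * eigenvalueDensity N _ (Real.exp (y / 2) : ℂ))) = _
  rw [← mul_assoc (ENNReal.ofReal Real.pi), ← ENNReal.ofReal_mul (by positivity), ← mul_assoc,
    ENNReal.ofReal_inv_of_pos (by positivity), ENNReal.inv_mul_cancel hA0 hAt, one_mul]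

theorem factorWeight_zero_zero (N : ℕ) : factorWeight N 0 0 = 1 := by
  simp [factorWeight]

/-- Only the degree k = 0 survives. For j ≥ 1 the Beta recurrence makes the ratio of the integrals
in ω(0) and H_0 equal to 1/λ_j, and for λ_j = 0 both this ratio and the inverse of 0 in [0, ∞] are
∞. The factor j = 0 contributes 1/N to H_0, which cancels the normalization. -/
theorem eigenvalueDensity_zero {m : ℕ} {lam : Fin (m + 1) → ℝ} (hlam : ∀ i, 0 ≤ lam i)
    (hlam0 : lam 0 = 0) {N : ℕ} (hN : 0 < N) :
    eigenvalueDensity N (fun i => lam i * (N : ℝ)) 0 =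
      (ENNReal.ofReal Real.pi)⁻¹ * ∏ j : Fin m, (ENNReal.ofReal (lam j.succ))⁻¹ := by
  have hN' : (0 : ℝ) < N := by exact_mod_cast hN
  rw [eigenvalueDensity_eq_sum hN fun i => by have := hlam i; positivity, weight_zero]
  have hrec : ∀ j : Fin m, ∫⁻ u, expKernel (lam j.succ * N) (lam j.succ * N + N + 1) u =
      (ENNReal.ofReal (lam j.succ))⁻¹ *
        ∫⁻ u, expKernel (lam j.succ * N + 1) (lam j.succ * N + N + 1) u := by
    intro j
    rcases (hlam j.succ).eq_or_lt with h | h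
    · rw [← h, zero_mul, lintegral_expKernel_zero (by positivity), ENNReal.ofReal_zero,
        ENNReal.inv_zero, ENNReal.top_mul (lintegral_expKernel_ne_zero _ _)]
    · have hr := lintegral_expKernel_recurrence (a := lam j.succ * N) (M := lam j.succ * N + N)
        (by positivity) (by linarith)
      rw [add_sub_cancel_left, ENNReal.ofReal_mul h.le, mul_comm (ENNReal.ofReal (lam j.succ)),
        mul_assoc] at hr
      have hc0 : ENNReal.ofReal (N : ℝ) ≠ 0 := by simpa using hN.ne'
      have hr' := (ENNReal.mul_right_inj hc0 ENNReal.ofReal_ne_top).1 hr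
      have hl0 : ENNReal.ofReal (lam j.succ) ≠ 0 := by simpa using h
      rw [← hr', ← mul_assoc, ENNReal.inv_mul_cancel hl0 ENNReal.ofReal_ne_top, one_mul]
  have hsum : ∀ H : ℕ → ℝ≥0∞, ∑ k ∈ Finset.range N, ‖(0 : ℂ)‖ₑ ^ (2 * k) / H k = (H 0)⁻¹ := by
    intro H
    rw [Finset.sum_eq_single_of_mem 0 (Finset.mem_range.2 hN)]
    · simp
    · intro k _ hk
      simp [hk]
  rw [hsum, Fin.prod_univ_succ]
  simp only [hlam0, zero_mul, Nat.cast_zero, add_zero, zero_add, factorWeight_zero_zero, one_mul,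
    hrec, Finset.prod_mul_distrib, Finset.prod_const, Finset.card_univ, Fintype.card_fin]
  rw [lintegral_expKernel_one hN.ne']
  set p := ENNReal.ofReal Real.pi with hp
  set n : ℝ≥0∞ := (N : ℝ≥0∞) with hn
  set J := ∏ j : Fin m, ∫⁻ u, expKernel (lam j.succ * N + 1) (lam j.succ * N + N + 1) u with hJ
  have hp0 : p ≠ 0 := by simp [hp, Real.pi_pos]
  have hpt : p ≠ ∞ := ENNReal.ofReal_ne_top
  have hn0 : n ≠ 0 := by simpa [hn] using hN.ne'
  have hnt : n ≠ ∞ := ENNReal.natCast_ne_top _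
  have hJ0 : J ≠ 0 := Finset.prod_ne_zero_iff.2 fun j _ => lintegral_expKernel_ne_zero _ _
  have hJt : J ≠ ∞ := ENNReal.prod_ne_top fun j _ => lintegral_expKernel_ne_top
    (by have := hlam j.succ; positivity) (by have := hlam j.succ; linarith)
  have hB0 : p ^ m * n⁻¹ * J ≠ 0 :=
    mul_ne_zero (mul_ne_zero (pow_ne_zero _ hp0) (ENNReal.inv_ne_zero.2 hnt)) hJ0
  have hBt : p ^ m * n⁻¹ * J ≠ ∞ := ENNReal.mul_ne_top
    (ENNReal.mul_ne_top (ENNReal.pow_ne_top hpt) (ENNReal.inv_ne_top.2 hn0)) hJt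
  set Q := ∏ j : Fin m, (ENNReal.ofReal (lam j.succ))⁻¹
  rw [show p ^ (m + 1) * (n⁻¹ * J) = p * (p ^ m * n⁻¹ * J) by ring,
    ENNReal.mul_inv (Or.inl hp0) (Or.inl hpt)]
  calc n⁻¹ * (p ^ m * (Q * J) * (p⁻¹ * (p ^ m * n⁻¹ * J)⁻¹))
      = (p ^ m * n⁻¹ * J) * (p ^ m * n⁻¹ * J)⁻¹ * (p⁻¹ * Q) := by ring
    _ = p⁻¹ * Q := by rw [ENNReal.mul_inv_cancel hB0 hBt, one_mul]

theorem eigenvalueDensity_congr {m : ℕ} (N : ℕ) (hN : 0 < N) {ν : Fin (m + 1) → ℝ}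
    (hν : ∀ i, 0 ≤ ν i) {x y : ℂ} (h : ‖x‖ = ‖y‖) :
    eigenvalueDensity N ν x = eigenvalueDensity N ν y := by
  rw [eigenvalueDensity_eq_sum hN hν, eigenvalueDensity_eq_sum hN hν, weight_congr N ν h]
  simp_rw [← ofReal_norm, h]

/-! ### The map μ from (0, 1) onto the line -/

section LogModulus

variable {m : ℕ} {lam : Fin (m + 1) → ℝ}

theorem hasDerivAt_logModulus (hlam : ∀ i, 0 ≤ lam i) {t : ℝ} (ht0 : 0 < t) (ht1 : t < 1) :
    HasDerivAt (logModulus lam) (logModulusDeriv lam t) t := by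
  have h1 : 0 < 1 - t := by linarith
  unfold logModulus logModulusDeriv
  refine HasDerivAt.fun_sum fun i _ => ?_
  have hl : 0 < t + lam i := by have := hlam i; linarith
  have h := (((hasDerivAt_id t).add_const (lam i)).div ((hasDerivAt_id t).const_sub 1) h1.ne').log
    (div_pos hl h1).ne'
  refine h.congr_deriv ?_
  simp only [Pi.div_apply, id]
  field_simp
  ring

theorem strictMonoOn_logModulus (hlam : ∀ i, 0 ≤ lam i) :
    StrictMonoOn (logModulus lam) (Set.Ioo 0 1) := by
  refine strictMonoOn_of_deriv_pos (convex_Ioo 0 1)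
    (fun t ht => (hasDerivAt_logModulus hlam ht.1 ht.2).continuousAt.continuousWithinAt)
    fun t ht => ?_
  rw [interior_Ioo] at ht
  rw [(hasDerivAt_logModulus hlam ht.1 ht.2).deriv]
  exact logModulusDeriv_pos hlam ht.1 ht.2

/-- Intermediate values, with t the logistic function of s, so that the summand with λ_0 = 0 is
exactly s. For s ≥ 0 all summands are nonnegative, so the sum is at least s. For s ≤ 0 the others
are at most log(1 + 2λ_i), so the sum falls below any bound. -/
theorem image_logModulus (hlam : ∀ i, 0 ≤ lam i) (hlam0 : lam 0 = 0) :
    logModulus lam '' Set.Ioo 0 1 = Set.univ := by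
  refine Set.eq_univ_of_forall fun y => ?_
  let τ : ℝ → ℝ := fun s => Real.exp s / (1 + Real.exp s)
  have hτ : ∀ s, τ s ∈ Set.Ioo (0 : ℝ) 1 := fun s => by
    refine ⟨by positivity, ?_⟩
    rw [div_lt_one (by positivity)]
    linarith
  have hτ1 : ∀ s, 1 - τ s = 1 / (1 + Real.exp s) := fun s => by
    simp only [τ]; field_simp; ring
  have hτr : ∀ s, τ s / (1 - τ s) = Real.exp s := fun s => by
    rw [hτ1]; simp only [τ]; field_simp
  have hhi : ∃ t ∈ Set.Ioo (0 : ℝ) 1, y ≤ logModulus lam t := by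
    refine ⟨τ (max y 0), hτ _, ?_⟩
    set s := max y 0 with hs
    have h0 : 0 ≤ s := le_max_right _ _
    have hi : ∀ i, s ≤ Real.log ((τ s + lam i) / (1 - τ s)) := by
      intro i
      rw [Real.le_log_iff_exp_le, ← hτr]
      · exact div_le_div_of_nonneg_right (by linarith [hlam i]) (by linarith [(hτ s).2])
      · exact div_pos (by linarith [hlam i, (hτ s).1]) (by linarith [(hτ s).2])
    have h := Finset.single_le_sum (f := fun i => Real.log ((τ s + lam i) / (1 - τ s)))
      (fun i _ => h0.trans (hi i)) (Finset.mem_univ (0 : Fin (m + 1)))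
    exact (le_max_left y 0).trans ((hi 0).trans h)
  have hlo : ∃ t ∈ Set.Ioo (0 : ℝ) 1, logModulus lam t ≤ y := by
    set C := ∑ i : Fin m, Real.log (1 + 2 * lam i.succ) with hC
    refine ⟨τ (min 0 (y - C)), hτ _, ?_⟩
    set s := min 0 (y - C) with hs
    have h0 : s ≤ 0 := min_le_left _ _
    have hes : Real.exp s ≤ 1 := Real.exp_le_one_iff.2 h0
    rw [logModulus, Fin.sum_univ_succ, hlam0, add_zero, hτr, Real.log_exp]
    have hi : ∑ i : Fin m, Real.log ((τ s + lam i.succ) / (1 - τ s)) ≤ C := by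
      refine Finset.sum_le_sum fun i _ => ?_
      refine Real.log_le_log
        (div_pos (by linarith [hlam i.succ, (hτ s).1]) (by linarith [(hτ s).2])) ?_
      rw [add_div, hτr, hτ1]
      have := hlam i.succ
      rw [div_div_eq_mul_div, div_one]
      nlinarith
    linarith [min_le_right 0 (y - C)]
  obtain ⟨t₁, ht₁, h₁⟩ := hlo
  obtain ⟨t₂, ht₂, h₂⟩ := hhi
  exact isPreconnected_Ioo.intermediate_value ht₁ ht₂
    (fun t ht => (hasDerivAt_logModulus hlam ht.1 ht.2).continuousAt.continuousWithinAt) ⟨h₁, h₂⟩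

theorem exp_mul_logModulus (hlam : ∀ i, 0 ≤ lam i) {t : ℝ} (ht0 : 0 < t) (ht1 : t < 1) (s : ℝ) :
    Real.exp (s * logModulus lam t) = ∏ i, ((t + lam i) ^ s / (1 - t) ^ s) := by
  have h1 : 0 < 1 - t := by linarith
  rw [logModulus, Finset.mul_sum, Real.exp_sum]
  refine Finset.prod_congr rfl fun i _ => ?_
  have hl : 0 < t + lam i := by have := hlam i; linarith
  rw [← Real.div_rpow hl.le h1.le, Real.rpow_def_of_pos (div_pos hl h1), mul_comm]

theorem abs_logModulus_le (hlam : ∀ i, 0 ≤ lam i) {t : ℝ} (ht0 : 0 < t) (ht1 : t < 1) :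
    |logModulus lam t| ≤ (m + 1) * (-Real.log t - Real.log (1 - t)) +
      ∑ i, Real.log (1 + lam i) := by
  have h1 : 0 < 1 - t := by linarith
  have hb : ∀ i, |Real.log ((t + lam i) / (1 - t))| ≤
      (-Real.log t - Real.log (1 - t)) + Real.log (1 + lam i) := by
    intro i
    have hli := hlam i
    have hl : 0 < t + lam i := by linarith
    rw [Real.log_div hl.ne' h1.ne']
    have h2 := Real.log_le_log ht0 (show t ≤ t + lam i by linarith)
    have h3 := Real.log_le_log hl (show t + lam i ≤ 1 + lam i by linarith)
    have h4 := Real.log_nonpos ht0.le ht1.le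
    have h5 := Real.log_nonpos h1.le (show 1 - t ≤ 1 by linarith)
    have h6 := Real.log_nonneg (show 1 ≤ 1 + lam i by linarith)
    rw [abs_le]
    constructor <;> linarith
  refine (Finset.abs_sum_le_sum_abs _ _).trans ((Finset.sum_le_sum fun i _ => hb i).trans ?_)
  rw [Finset.sum_add_distrib, Finset.sum_const, Finset.card_univ, Fintype.card_fin, nsmul_eq_mul]
  push_cast
  rfl

/-- A neighbourhood of s = 0 is all that uniqueness needs. For such s the integrand is at most e^L
(t(1 - t))^(-1/4), and by the arithmetic-geometric mean this is at most e^L/2 times t^(-1/2) + (1 -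
t)^(-1/2), which is integrable. -/
theorem lintegral_exp_mul_logModulus_ne_top (hlam : ∀ i, 0 ≤ lam i) {s : ℝ}
    (hs : |s| < 1 / (4 * (m + 1))) :
    ∫⁻ t in Set.Ioo (0 : ℝ) 1, ENNReal.ofReal (Real.exp (s * logModulus lam t)) ≠ ∞ := by
  set L := ∑ i, Real.log (1 + lam i) with hL
  have hL0 : 0 ≤ L := Finset.sum_nonneg fun i _ => Real.log_nonneg (by linarith [hlam i])
  have hi1 : IntervalIntegrable (fun t : ℝ => t ^ (-(1 / 2) : ℝ)) volume 0 1 :=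
    intervalIntegral.intervalIntegrable_rpow' (by norm_num)
  have hi2 : IntervalIntegrable (fun t : ℝ => (1 - t) ^ (-(1 / 2) : ℝ)) volume 0 1 := by
    simpa using! (hi1.comp_sub_left 1).symm
  have hi := (hi1.add hi2).const_mul (Real.exp L / 2)
  rw [intervalIntegrable_iff_integrableOn_Ioo_of_le zero_le_one] at hi
  refine ne_top_of_le_ne_top hi.lintegral_lt_top.ne (setLIntegral_mono' measurableSet_Ioo ?_)
  rintro t ⟨ht0, ht1⟩
  have h1 : 0 < 1 - t := by linarith
  refine ENNReal.ofReal_le_ofReal ?_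
  simp only [Real.rpow_def_of_pos ht0, Real.rpow_def_of_pos h1]
  set a := -Real.log t with ha
  set b := -Real.log (1 - t) with hb
  have ha0 : 0 ≤ a := by have := Real.log_nonpos ht0.le ht1.le; linarith
  have hb0 : 0 ≤ b := by have := Real.log_nonpos h1.le (show 1 - t ≤ 1 by linarith); linarith
  have hmain : s * logModulus lam t ≤ L + (a / 4 + b / 4) := by
    have h2 := abs_logModulus_le hlam ht0 ht1
    have h3 : |s| * |logModulus lam t| ≤
        1 / (4 * (m + 1)) * ((m + 1) * (-Real.log t - Real.log (1 - t)) + L) :=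
      mul_le_mul hs.le h2 (abs_nonneg _) (by positivity)
    have h4 : s * logModulus lam t ≤ |s| * |logModulus lam t| := by
      rw [← abs_mul]; exact le_abs_self _
    have h5 : 1 / (4 * ((m : ℝ) + 1)) * ((m + 1) * (-Real.log t - Real.log (1 - t)) + L) =
        (a / 4 + b / 4) + 1 / (4 * (m + 1)) * L := by
      rw [ha, hb]; field_simp; ring
    have h6 : 1 / (4 * ((m : ℝ) + 1)) * L ≤ L := by
      refine mul_le_of_le_one_left hL0 ?_
      rw [div_le_one (by positivity)]
      have : (0 : ℝ) ≤ m := by positivity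
      linarith
    linarith
  refine (Real.exp_le_exp.2 hmain).trans ?_
  have e1 : Real.exp (Real.log t * -(1 / 2)) = Real.exp (a / 4) ^ 2 := by
    rw [← Real.exp_nat_mul]; congr 1; rw [ha]; push_cast; ring
  have e2 : Real.exp (Real.log (1 - t) * -(1 / 2)) = Real.exp (b / 4) ^ 2 := by
    rw [← Real.exp_nat_mul]; congr 1; rw [hb]; push_cast; ring
  rw [e1, e2, Real.exp_add, Real.exp_add]
  have := Real.exp_pos L
  nlinarith [sq_nonneg (Real.exp (a / 4) - Real.exp (b / 4))]

end LogModulus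

/-! ### Determination of a measure by its Laplace transform -/

/-- A measure on the line is determined by its Laplace transform near the origin. -/
theorem measure_ext_of_lintegral_exp {μ ν : Measure ℝ} {r : ℝ} (hr : 0 < r)
    (h : ∀ s, |s| < r → ∫⁻ x, ENNReal.ofReal (Real.exp (s * x)) ∂μ =
      ∫⁻ x, ENNReal.ofReal (Real.exp (s * x)) ∂ν)
    (hfin : ∀ s, |s| < r → ∫⁻ x, ENNReal.ofReal (Real.exp (s * x)) ∂μ ≠ ∞) : μ = ν := by
  have hint : ∀ κ : Measure ℝ,
      (∀ s, |s| < r → ∫⁻ x, ENNReal.ofReal (Real.exp (s * x)) ∂κ ≠ ∞) →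
      ∀ s, |s| < r → Integrable (fun x => Real.exp (s * x)) κ := by
    intro κ hκ s hs
    refine ⟨by fun_prop, ?_⟩
    rw [hasFiniteIntegral_iff_ofReal (Eventually.of_forall fun x => by positivity)]
    exact (hκ s hs).lt_top
  have hfin' : ∀ s, |s| < r → ∫⁻ x, ENNReal.ofReal (Real.exp (s * x)) ∂ν ≠ ∞ :=
    fun s hs => h s hs ▸ hfin s hs
  have h0 : |(0 : ℝ)| < r := by simpa
  have hμ : IsFiniteMeasure μ := ⟨by simpa using (hfin 0 h0).lt_top⟩
  have hν : IsFiniteMeasure ν := ⟨by simpa using (hfin' 0 h0).lt_top⟩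
  have hsub : ∀ κ : Measure ℝ,
      (∀ s, |s| < r → ∫⁻ x, ENNReal.ofReal (Real.exp (s * x)) ∂κ ≠ ∞) →
      {z : ℂ | z.re ∈ Set.Ioo (-r) r} ⊆
        {z : ℂ | z.re ∈ interior (ProbabilityTheory.integrableExpSet id κ)} := by
    intro κ hκ z hz
    refine interior_mono (s := Set.Ioo (-r) r) (fun s hs => ?_) (by rwa [interior_Ioo])
    exact hint κ hκ s (abs_lt.2 hs)
  have hconv : IsPreconnected {z : ℂ | z.re ∈ Set.Ioo (-r) r} :=
    ((convex_Ioo (-r) r).linear_preimage Complex.reLm).isPreconnected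
  -- Both complex Laplace transforms are analytic on the strip |Re z| < r and agree on the real
  -- points near 0, hence on the whole strip. Its imaginary axis gives the characteristic functions.
  have heq := (ProbabilityTheory.analyticOnNhd_complexMGF.mono
    (hsub μ hfin)).eqOn_of_preconnected_of_frequently_eq
    (ProbabilityTheory.analyticOnNhd_complexMGF.mono (hsub ν hfin')) hconv
    (z₀ := ((0 : ℝ) : ℂ)) (by simp [hr]) (by
      have h_real : ∃ᶠ x : ℝ in 𝓝[≠] 0, ProbabilityTheory.complexMGF id μ x =
          ProbabilityTheory.complexMGF id ν x := by
        refine Eventually.frequently ?_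
        have : ∀ᶠ x : ℝ in 𝓝[≠] 0, |x| < r := by
          refine nhdsWithin_le_nhds ?_
          exact (continuous_abs.tendsto (0 : ℝ)).eventually (gt_mem_nhds h0)
        filter_upwards [this] with s hs
        rw [ProbabilityTheory.complexMGF_ofReal, ProbabilityTheory.complexMGF_ofReal,
          ProbabilityTheory.mgf, ProbabilityTheory.mgf]
        simp only [id]
        rw [integral_eq_lintegral_of_nonneg_ae (Eventually.of_forall fun x => by positivity)
          (by fun_prop), integral_eq_lintegral_of_nonneg_ae
          (Eventually.of_forall fun x => by positivity) (by fun_prop), h s hs]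
      have hmap : Tendsto (fun x : ℝ => (x : ℂ)) (𝓝[≠] 0) (𝓝[≠] ((0 : ℝ) : ℂ)) := by
        refine tendsto_nhdsWithin_iff.2 ⟨?_, ?_⟩
        · exact (Complex.continuous_ofReal.tendsto 0).mono_left nhdsWithin_le_nhds
        · filter_upwards [self_mem_nhdsWithin] with x hx
          simpa using hx
      exact hmap.frequently h_real)
  refine Measure.ext_of_charFun (funext fun t => ?_)
  rw [← ProbabilityTheory.complexMGF_id_mul_I, ← ProbabilityTheory.complexMGF_id_mul_I]
  exact heq (by simp [hr])

/-! ### The limiting density: convergence, moments, uniqueness, equal parameters -/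

section MacroscopicDensity

variable {m : ℕ} {lam : Fin (m + 1) → ℝ}

/-- The limiting density: the law of a rotation invariant variable whose squared modulus is
`∏ᵢ (t + λᵢ) / (1 - t)` with `t` uniform in `(0, 1)`. -/
noncomputable def macroscopicDensity (lam : Fin (m + 1) → ℝ) (z : ℂ) : ℝ≥0∞ :=
  if z = 0 then (ENNReal.ofReal Real.pi)⁻¹ * ∏ j : Fin m, (ENNReal.ofReal (lam j.succ))⁻¹
  else ENNReal.ofReal (1 / (Real.pi * ‖z‖ ^ 2 *
    logModulusDeriv lam (Function.invFunOn (logModulus lam) (Set.Ioo 0 1) (Real.log (‖z‖ ^ 2)))))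

theorem exists_logModulus_eq (hlam : ∀ i, 0 ≤ lam i) (hlam0 : lam 0 = 0) (y : ℝ) :
    ∃ t ∈ Set.Ioo (0 : ℝ) 1, logModulus lam t = y := by
  have : y ∈ logModulus lam '' Set.Ioo 0 1 := by
    rw [image_logModulus hlam hlam0]
    trivial
  exact this

theorem macroscopicDensity_of_norm (hlam : ∀ i, 0 ≤ lam i) {t : ℝ} (ht : t ∈ Set.Ioo (0 : ℝ) 1)
    {z : ℂ} (hz : ‖z‖ = Real.exp (logModulus lam t / 2)) :
    macroscopicDensity lam z = ENNReal.ofReal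
      (1 / (Real.pi * Real.exp (logModulus lam t) * logModulusDeriv lam t)) := by
  have hz0 : z ≠ 0 := by
    rw [← norm_pos_iff, hz]
    positivity
  have hsq : ‖z‖ ^ 2 = Real.exp (logModulus lam t) := by
    rw [hz, ← Real.exp_nat_mul]
    congr 1
    push_cast; ring
  rw [macroscopicDensity, if_neg hz0, hsq, Real.log_exp,
    (strictMonoOn_logModulus hlam).injOn.leftInvOn_invFunOn ht]

theorem exists_norm_eq_exp (hlam : ∀ i, 0 ≤ lam i) (hlam0 : lam 0 = 0) {z : ℂ} (hz : z ≠ 0) :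
    ∃ t ∈ Set.Ioo (0 : ℝ) 1, ‖z‖ = Real.exp (logModulus lam t / 2) := by
  obtain ⟨t, ht, he⟩ := exists_logModulus_eq hlam hlam0 (2 * Real.log ‖z‖)
  refine ⟨t, ht, ?_⟩
  rw [he, mul_div_cancel_left₀ _ two_ne_zero, Real.exp_log (norm_pos_iff.2 hz)]

theorem tendsto_eigenvalueDensity (hlam : ∀ i, 0 ≤ lam i) (hlam0 : lam 0 = 0) (z : ℂ) :
    Tendsto (fun N : ℕ => eigenvalueDensity N (fun i => lam i * (N : ℝ)) z) atTop
      (𝓝 (macroscopicDensity lam z)) := by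
  have hν : ∀ (N : ℕ) i, 0 ≤ lam i * (N : ℝ) := fun N i => by have := hlam i; positivity
  rcases eq_or_ne z 0 with rfl | hz
  · rw [macroscopicDensity, if_pos rfl]
    refine tendsto_const_nhds.congr' ?_
    filter_upwards [eventually_gt_atTop 0] with N hN
    exact (eigenvalueDensity_zero hlam hlam0 hN).symm
  · obtain ⟨t, ht, he⟩ := exists_norm_eq_exp hlam hlam0 hz
    rw [macroscopicDensity_of_norm hlam ht he]
    refine (tendsto_eigenvalueDensity_exp hlam ht.1 ht.2).congr' ?_
    filter_upwards [eventually_gt_atTop 0] with N hN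
    refine eigenvalueDensity_congr N hN (hν N) ?_
    rw [he, Complex.norm_real, Real.norm_of_nonneg (by positivity)]

/-- Measurability is inherited from the prelimit densities, which avoids studying the inverse of μ.
The shift to N + 1 leaves out N = 0. -/
theorem measurable_macroscopicDensity (hlam : ∀ i, 0 ≤ lam i) (hlam0 : lam 0 = 0) :
    Measurable (macroscopicDensity lam) := by
  refine measurable_of_tendsto_metrizable
    (f := fun N : ℕ => eigenvalueDensity (N + 1) fun i => lam i * ((N + 1 : ℕ) : ℝ))
    (fun N => measurable_eigenvalueDensity N.succ_pos fun i => by have := hlam i; positivity)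
    (tendsto_pi_nhds.2 fun z => ?_)
  exact (tendsto_add_atTop_iff_nat 1).2 (tendsto_eigenvalueDensity hlam hlam0 z)

theorem macroscopicDensity_congr {z w : ℂ} (h : ‖z‖ = ‖w‖) :
    macroscopicDensity lam z = macroscopicDensity lam w := by
  have h0 : z = 0 ↔ w = 0 := by rw [← norm_eq_zero, h, norm_eq_zero]
  simp only [macroscopicDensity, h, h0]

/-- The density of `log |z|²` for a rotation invariant density on the plane. -/
noncomputable def logDensity (ρ : ℂ → ℝ≥0∞) (u : ℝ) : ℝ≥0∞ :=
  ENNReal.ofReal Real.pi * (ENNReal.ofReal (Real.exp u) * ρ (Real.exp (u / 2) : ℂ))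

theorem measurable_logDensity {ρ : ℂ → ℝ≥0∞} (hρ : Measurable ρ) : Measurable (logDensity ρ) := by
  unfold logDensity
  fun_prop

/-- Turns the moments of a radial density into the Laplace transform of the law of log |z|². -/
theorem lintegral_norm_rpow_mul {ρ : ℂ → ℝ≥0∞} (hρ : Measurable ρ)
    (hrad : ∀ z w : ℂ, ‖z‖ = ‖w‖ → ρ z = ρ w) (s : ℝ) :
    ∫⁻ z : ℂ, ‖z‖ₑ ^ (2 * s) * ρ z =
      ∫⁻ u, ENNReal.ofReal (Real.exp (s * u)) * logDensity ρ u := by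
  let f : ℝ → ℝ≥0∞ := fun r => ‖r‖ₑ ^ (2 * s) * ρ (r : ℂ)
  have hf : Measurable f := by fun_prop
  have h1 : ∀ z : ℂ, ‖z‖ₑ ^ (2 * s) * ρ z = f ‖z‖ := by
    intro z
    simp only [f, enorm_norm]
    rw [hrad z (‖z‖ : ℂ) (by simp)]
  rw [lintegral_congr h1, lintegral_norm_eq hf, ← lintegral_const_mul _ (by fun_prop)]
  refine lintegral_congr fun u => ?_
  have h2 : ‖Real.exp (u / 2)‖ₑ ^ (2 * s) = ENNReal.ofReal (Real.exp (s * u)) := by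
    rw [Real.enorm_of_nonneg (by positivity), ENNReal.ofReal_rpow_of_pos (by positivity),
      ← Real.exp_mul]
    congr 2; ring
  simp only [f, h2, logDensity]
  ring

/-- Substituting u = μ(t), the Jacobian μ'(t) cancels the density 1/μ'(t) of log |z|². Nothing has
to converge, so s is arbitrary. -/
theorem lintegral_norm_rpow_mul_macroscopicDensity (hlam : ∀ i, 0 ≤ lam i) (hlam0 : lam 0 = 0)
    (s : ℝ) : ∫⁻ z : ℂ, ‖z‖ₑ ^ (2 * s) * macroscopicDensity lam z =
      ∫⁻ t in Set.Ioo (0 : ℝ) 1, ENNReal.ofReal (Real.exp (s * logModulus lam t)) := by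
  rw [lintegral_norm_rpow_mul (measurable_macroscopicDensity hlam hlam0)
    (fun _ _ => macroscopicDensity_congr), ← setLIntegral_univ, ← image_logModulus hlam hlam0,
    lintegral_image_eq_lintegral_abs_deriv_mul measurableSet_Ioo
      (fun t ht => (hasDerivAt_logModulus hlam ht.1 ht.2).hasDerivWithinAt)
      (strictMonoOn_logModulus hlam).injOn]
  refine setLIntegral_congr_fun measurableSet_Ioo fun t ht => ?_
  have hd := logModulusDeriv_pos hlam ht.1 ht.2
  simp only [logDensity]
  rw [macroscopicDensity_of_norm hlam ht (by
      rw [Complex.norm_real, Real.norm_of_nonneg (by positivity)]), abs_of_pos hd,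
    ← ENNReal.ofReal_mul (by positivity), ← ENNReal.ofReal_mul (by positivity),
    ← ENNReal.ofReal_mul (by positivity), ← ENNReal.ofReal_mul hd.le]
  congr 1
  field_simp

theorem isMacroscopicDensity_macroscopicDensity (hlam : ∀ i, 0 ≤ lam i) (hlam0 : lam 0 = 0) :
    IsMacroscopicDensity lam (macroscopicDensity lam) where
  measurable := measurable_macroscopicDensity hlam hlam0
  radial _ _ := macroscopicDensity_congr
  mellin s _ := by
    rw [lintegral_norm_rpow_mul_macroscopicDensity hlam hlam0]
    exact setLIntegral_congr_fun measurableSet_Ioo fun t ht => by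
      simp only [exp_mul_logModulus hlam ht.1 ht.2]

/-- The laws of log |z|² have the same finite Laplace transform near 0 and so coincide. The case s =
0 gives finite mass, so their densities agree almost everywhere on the line. -/
theorem IsMacroscopicDensity.ae_eq (hlam : ∀ i, 0 ≤ lam i) {σ ρ : ℂ → ℝ≥0∞}
    (hσ : IsMacroscopicDensity lam σ) (hρ : IsMacroscopicDensity lam ρ) : σ =ᵐ[volume] ρ := by
  have hr : (0 : ℝ) < 1 / (4 * (m + 1)) := by positivity
  have hrs : ∀ s : ℝ, |s| < 1 / (4 * (m + 1)) → s < 1 / ((m : ℝ) + 1) := by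
    intro s hs
    refine (le_abs_self s).trans_lt (hs.trans_le ?_)
    refine one_div_le_one_div_of_le (by positivity) ?_
    have : (0 : ℝ) ≤ m := by positivity
    linarith
  have hM : ∀ τ : ℂ → ℝ≥0∞, IsMacroscopicDensity lam τ → ∀ s : ℝ, |s| < 1 / (4 * (m + 1)) →
      ∫⁻ u, ENNReal.ofReal (Real.exp (s * u)) * logDensity τ u =
      ∫⁻ t in Set.Ioo (0 : ℝ) 1, ENNReal.ofReal (Real.exp (s * logModulus lam t)) := by
    intro τ hτ s hs
    rw [← lintegral_norm_rpow_mul hτ.measurable hτ.radial, hτ.mellin s (hrs s hs)]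
    exact setLIntegral_congr_fun measurableSet_Ioo fun t ht => by
      simp only [exp_mul_logModulus hlam ht.1 ht.2]
  have hW : ∀ τ : ℂ → ℝ≥0∞, IsMacroscopicDensity lam τ → ∀ s : ℝ, |s| < 1 / (4 * (m + 1)) →
      ∫⁻ u, ENNReal.ofReal (Real.exp (s * u)) ∂(volume.withDensity (logDensity τ)) =
      ∫⁻ t in Set.Ioo (0 : ℝ) 1, ENNReal.ofReal (Real.exp (s * logModulus lam t)) := by
    intro τ hτ s hs
    rw [← hM τ hτ s hs, lintegral_withDensity_eq_lintegral_mul _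
      (measurable_logDensity hτ.measurable) (by fun_prop)]
    exact lintegral_congr fun u => mul_comm _ _
  have heq : volume.withDensity (logDensity σ) = volume.withDensity (logDensity ρ) :=
    measure_ext_of_lintegral_exp hr (fun s hs => by rw [hW σ hσ s hs, hW ρ hρ s hs])
      fun s hs => by
        rw [hW σ hσ s hs]
        exact lintegral_exp_mul_logModulus_ne_top hlam hs
  have hσt : ∫⁻ u, logDensity σ u ≠ ∞ := by
    have h0 : |(0 : ℝ)| < 1 / (4 * (m + 1)) := by rw [abs_zero]; exact hr
    have h := hM σ hσ 0 h0
    have h' := lintegral_exp_mul_logModulus_ne_top hlam h0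
    rw [← h] at h'
    simpa using h'
  have hae := (withDensity_eq_iff (measurable_logDensity hσ.measurable).aemeasurable
    (measurable_logDensity hρ.measurable).aemeasurable hσt).1 heq
  have hae' : ∀ᵐ u : ℝ, σ (Real.exp (u / 2) : ℂ) = ρ (Real.exp (u / 2) : ℂ) := by
    filter_upwards [hae] with u hu
    have h1 : ENNReal.ofReal Real.pi ≠ 0 := by simp [Real.pi_pos]
    have h2 : ENNReal.ofReal (Real.exp u) ≠ 0 := by simp [Real.exp_pos]
    exact (ENNReal.mul_right_inj h2 ENNReal.ofReal_ne_top).1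
      ((ENNReal.mul_right_inj h1 ENNReal.ofReal_ne_top).1 hu)
  -- Radii where the two densities differ. Integrating the indicator of S radially shows that these
  -- radii fill only a null set of the plane.
  let S : Set ℝ := {r | σ (r : ℂ) ≠ ρ (r : ℂ)}
  have hS : MeasurableSet S :=
    (measurableSet_eq_fun (hσ.measurable.comp Complex.measurable_ofReal)
      (hρ.measurable.comp Complex.measurable_ofReal)).compl
  have hg : Measurable (S.indicator (1 : ℝ → ℝ≥0∞)) := measurable_one.indicator hS
  have hzero : ∫⁻ z : ℂ, S.indicator (1 : ℝ → ℝ≥0∞) ‖z‖ = 0 := by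
    rw [lintegral_norm_eq hg, lintegral_eq_zero_iff (by fun_prop) |>.2, mul_zero]
    filter_upwards [hae'] with u hu
    have : Real.exp (u / 2) ∉ S := fun h => h hu
    simp [this]
  rw [lintegral_eq_zero_iff (by fun_prop)] at hzero
  filter_upwards [hzero] with z hz
  by_contra hne
  have : ‖z‖ ∈ S := by
    intro h
    apply hne
    rw [hσ.radial z (‖z‖ : ℂ) (by simp), hρ.radial z (‖z‖ : ℂ) (by simp), h]
  simp [Set.indicator_of_mem this] at hz

theorem macroscopicDensity_eq_squareDensity (h0 : ∀ i, lam i = 0) (z : ℂ) :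
    macroscopicDensity lam z = squareDensity (m + 1) z := by
  have hn : (0 : ℝ) < ((m + 1 : ℕ) : ℝ) := by positivity
  rcases eq_or_ne z 0 with rfl | hz
  · rw [macroscopicDensity, if_pos rfl, squareDensity, enorm_zero]
    have h2 : (0 : ℝ≥0∞) ^ (2 / ((m + 1 : ℕ) : ℝ)) = 0 := ENNReal.zero_rpow_of_pos (by positivity)
    rw [h2, add_zero, one_pow, div_one]
    rcases Nat.eq_zero_or_pos m with rfl | hm
    -- For n = 1 the exponent is 0 and 0^0 = 1, while the product over j is empty: both sides are
    -- 1/π.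
    · simp [ENNReal.ofReal_inv_of_pos Real.pi_pos]
    · have hm' : (0 : ℝ) < m := by exact_mod_cast hm
      have hneg : (2 - 2 * ((m + 1 : ℕ) : ℝ)) / ((m + 1 : ℕ) : ℝ) < 0 := by
        refine div_neg_of_neg_of_pos ?_ hn
        push_cast
        linarith
      rw [ENNReal.zero_rpow_of_neg hneg, ENNReal.mul_top]
      · simp only [h0, ENNReal.ofReal_zero, ENNReal.inv_zero, Finset.prod_const, Finset.card_univ,
          Fintype.card_fin]
        rw [ENNReal.top_pow hm.ne', ENNReal.mul_top]
        exact ENNReal.inv_ne_zero.2 ENNReal.ofReal_ne_top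
      · rw [Ne, ENNReal.ofReal_eq_zero, not_le]
        positivity
  · have hlam : ∀ i, 0 ≤ lam i := fun i => (h0 i).ge
    obtain ⟨t, ht, he⟩ := exists_norm_eq_exp hlam (h0 0) hz
    have ht0 : 0 < t := ht.1
    have h1 : 0 < 1 - t := by linarith [ht.2]
    rw [macroscopicDensity_of_norm hlam ht he, squareDensity, ← ofReal_norm]
    have hr : 0 < ‖z‖ := norm_pos_iff.2 hz
    set r := ‖z‖ with hrdef
    set n : ℝ := ((m + 1 : ℕ) : ℝ) with hndef
    have hlm : logModulus lam t = n * Real.log (t / (1 - t)) := by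
      simp [logModulus, h0, hndef]
    have hld : logModulusDeriv lam t = n * (1 / (t * (1 - t))) := by
      simp [logModulusDeriv, h0, hndef]
    -- With all λ_i = 0 the map μ is n log(t / (1 - t)), so t is an explicit function of |z|^(2/n).
    have hq : r ^ (2 / n) = t / (1 - t) := by
      rw [he, ← Real.exp_mul, hlm]
      rw [show n * Real.log (t / (1 - t)) / 2 * (2 / n) = Real.log (t / (1 - t)) by field_simp,
        Real.exp_log (by positivity)]
    have hsq : Real.exp (logModulus lam t) = r ^ 2 := by
      rw [he, ← Real.exp_nat_mul]
      congr 1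
      push_cast; ring
    have hp : r ^ ((2 - 2 * n) / n) = r ^ (2 / n) / r ^ 2 := by
      rw [show (2 - 2 * n) / n = 2 / n - 2 by field_simp, Real.rpow_sub hr]
      norm_cast
    rw [ENNReal.ofReal_rpow_of_pos hr, ENNReal.ofReal_rpow_of_pos hr, ← ENNReal.ofReal_one,
      ← ENNReal.ofReal_add zero_le_one (by positivity), ← ENNReal.ofReal_pow (by positivity),
      ← ENNReal.ofReal_div_of_pos (by positivity), ← ENNReal.ofReal_mul (by positivity), hp, hq,
      hld, hsq]
    congr 1
    have h3 : 1 + t / (1 - t) = 1 / (1 - t) := by field_simp; ring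
    rw [h3]
    field_simp

theorem macroscopicDensity_ne_top (lam : Fin (m + 1) → ℝ) {z : ℂ} (hz : z ≠ 0) :
    macroscopicDensity lam z ≠ ∞ := by
  rw [macroscopicDensity, if_neg hz]
  exact ENNReal.ofReal_ne_top

end MacroscopicDensity

end CauchyProduct

theorem mainTheorem3 (m : ℕ) (lam : Fin (m + 1) → ℝ) (hlam : ∀ i, 0 ≤ lam i)
    (hlam0 : lam 0 = 0) :
    ∃ ρ : ℂ → ℝ≥0∞,
      (∀ z : ℂ, Tendsto
        (fun N : ℕ => CauchyProduct.eigenvalueDensity N (fun i => lam i * (N : ℝ)) z)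
        atTop (𝓝 (ρ z))) ∧
      (∀ z : ℂ, z ≠ 0 → ρ z ≠ ∞) ∧
      CauchyProduct.IsMacroscopicDensity lam ρ ∧
      (∀ σ : ℂ → ℝ≥0∞, CauchyProduct.IsMacroscopicDensity lam σ → σ =ᵐ[volume] ρ) ∧
      ((∀ i, lam i = 0) → ∀ z : ℂ, ρ z = CauchyProduct.squareDensity (m + 1) z) := by
  have hρ := CauchyProduct.isMacroscopicDensity_macroscopicDensity hlam hlam0
  exact ⟨CauchyProduct.macroscopicDensity lam,
    CauchyProduct.tendsto_eigenvalueDensity hlam hlam0,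
    fun z hz => CauchyProduct.macroscopicDensity_ne_top lam hz, hρ, fun σ hσ => hσ.ae_eq hlam hρ,
    CauchyProduct.macroscopicDensity_eq_squareDensity⟩
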